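/- **Setting.** Let $1\le p\le n$. Let $\mathrm{Sym}^2(\mathbb R^n)$ be the space of symmetric $n\times n$ matrices with $\langle A,B\rangle=\mathrm{tr}(AB)$, and identify a $p$-plane $\xi$ in the Grassmannian $G(p,\mathbb R^n)$ with the orthogonal projection $P_\xi$ onto $\xi$. For a closed set $G\subset G(p,\mathbb R^n)$ let $\mathcal P_+(G)$ be the closed convex cone, with vertex at the origin, generated by $\{P_\xi:\xi\in G\}$, and let $\mathcal P^+=\mathcal P^+(G)=\{A:\langle A,B\rangle\ge 0\ \ \forall B\in\mathcal P_+(G)\}$ be its polar. $G$ is *elliptic* if every $A$ in the interior of $\mathcal P_+(G)$ relative to its linear span is positive definite. For a topological space $S$, $\mathrm{USC}(S)$ denotes the upper semicontinuous functions $S\to[-\infty,\infty)$ that are not identically $-\infty$ on any connected component of $S$. Let $X\subset\mathbb R^n$ be a connected open set. A distribution $T\in\mathcal D'(X)$ is *$\mathcal P^+$-plurisubharmonic* if $\langle\mathrm{Hess}\,T,A\rangle(\varphi)\ge 0$ for all $A$ in the polar $\mathcal P_+=\mathcal P_+(G)$ of $\mathcal P^+$ and all test functions $\varphi\ge 0$.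 A function $u:X\to[-\infty,\infty)$ is *u.s.c. $\mathcal P^+$-plurisubharmonic* if it is the canonical representative of such a $T$: there is $f\in L^1_{\rm loc}(X)$ representing $T$ such that $u(x)=\operatorname{ess\,limsup}_{y\to x}f(y)$ for all $x\in X$, $u\in\mathrm{USC}(X)$, and $u=f$ almost everywhere. On a Riemannian manifold $M$ (in particular, on an open subset of a Euclidean space), a function $v$ is *subharmonic* if $v\in\mathrm{USC}(M)$ and, for every compact $K\subset M$ and every function $h$ harmonic (for the Laplace–Beltrami operator) on a neighbourhood of $K$, $v\le h$ on $\partial K$ implies $v\le h$ on $K$. **Theorem 5.6.** Let $G\subset G(p,\mathbb R^n)$ be elliptic and let $u$ be a u.s.c. $\mathcal P^+(G)$-plurisubharmonic function on $X$. 1. Let $W$ be an affine $p$-plane whose direction belongs to $G$ and such that $W\cap X$ is connected (and non-empty). Then either $u|_{W\cap X}\equiv-\infty$, or $u|_{W\cap X}$ is subharmonic for the Euclidean metric of $W$. 2. More generally, let $M$ be a connected smooth (possibly only immersed) $p$-dimensional submanifold of $X$ with $T_xM\in G$ for all $x\in M$. If $M$ is minimal, i.e. its mean curvature vector vanishes identically,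 then either $u|_M\equiv-\infty$, or $u|_M$ is subharmonic for the induced Riemannian metric on $M$. -/

import Mathlib

open Set Filter Topology MeasureTheory
open scoped Manifold ContDiff InnerProductSpace Distributions LineDeriv

noncomputable section

/-! ### Cones of symmetric operators

`Sym²(ℝⁿ)` is the space of self-adjoint elements of `ℝⁿ →L[ℝ] ℝⁿ`, with `⟨A, B⟩ = tr (A B)`. -/

/-- `ℝⁿ` with its Euclidean structure. -/
abbrev Euc (n : ℕ) : Type := EuclideanSpace ℝ (Fin n)

/-- The trace inner product `⟨A, B⟩ = tr (A B)`. -/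
def trInner {n : ℕ} (A B : Euc n →L[ℝ] Euc n) : ℝ :=
  LinearMap.trace ℝ (Euc n) (A ∘L B : Euc n →L[ℝ] Euc n)

/-- The polar `{A ∈ Sym²(ℝⁿ) : ⟨A, B⟩ ≥ 0 for all B ∈ C}` of a cone `C`. -/
def polarCone {n : ℕ} (C : Set (Euc n →L[ℝ] Euc n)) : Set (Euc n →L[ℝ] Euc n) :=
  {A | IsSelfAdjoint A ∧ ∀ B ∈ C, 0 ≤ trInner A B}

/-- The image of a set `G` of planes under `ξ ↦ P_ξ` (orthogonal projection onto `ξ`). -/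
def projections {n : ℕ} (G : Set (Submodule ℝ (Euc n))) : Set (Euc n →L[ℝ] Euc n) :=
  (fun ξ : Submodule ℝ (Euc n) => ξ.starProjection) '' G

/-- `𝒫₊(G)`: the closed convex cone with vertex at the origin generated by `{P_ξ : ξ ∈ G}`. -/
def lowerCone {n : ℕ} (G : Set (Submodule ℝ (Euc n))) : Set (Euc n →L[ℝ] Euc n) :=
  closure (PointedCone.hull ℝ (projections G) : Set (Euc n →L[ℝ] Euc n))

/-- `𝒫⁺(G)`: the polar of `𝒫₊(G)`. -/
def upperCone {n : ℕ} (G : Set (Submodule ℝ (Euc n))) : Set (Euc n →L[ℝ] Euc n) :=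
  polarCone (lowerCone G)

/-- `G` is an elliptic subset of the Grassmannian `G(p, ℝⁿ)`: a closed set of `p`-planes (the
Grassmannian being topologized by `ξ ↦ P_ξ`) such that every element of the interior of `𝒫₊(G)`
relative to its linear span is positive definite. The affine span of `𝒫₊(G)` used by
`intrinsicInterior` is the linear span, because `0 ∈ 𝒫₊(G)`. -/
structure IsEllipticSet {n : ℕ} (p : ℕ) (G : Set (Submodule ℝ (Euc n))) : Prop where
  finrank_eq : ∀ ξ ∈ G, Module.finrank ℝ ξ = p
  isClosed : IsClosed (projections G)
  posDef : ∀ A ∈ intrinsicInterior ℝ (lowerCone G), ∀ x : Euc n, x ≠ 0 → 0 < ⟪A x, x⟫_ℝ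

/-! ### Plurisubharmonic distributions and their upper semicontinuous representatives -/

/-- The distribution `Δ_A T = ⟨Hess T, A⟩ = ∑ᵢⱼ Aᵢⱼ ∂ᵢ ∂ⱼ T`. -/
def distLaplacian {n : ℕ} {X : TopologicalSpace.Opens (Euc n)} (A : Euc n →L[ℝ] Euc n)
    (T : 𝓓'(X, ℝ)) : 𝓓'(X, ℝ) :=
  ∑ i : Fin n, ∑ j : Fin n, (A (EuclideanSpace.single j 1) i) •
    ∂_{EuclideanSpace.single i (1 : ℝ)} (∂_{EuclideanSpace.single j (1 : ℝ)} T)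

/-- `T` is a `P`-plurisubharmonic distribution, for a closed convex cone `P = 𝒫⁺` with
polar `𝒫₊`: `⟨Hess T, A⟩ ≥ 0` for all `A ∈ 𝒫₊`. -/
def IsPshDistribution {n : ℕ} {X : TopologicalSpace.Opens (Euc n)}
    (P : Set (Euc n →L[ℝ] Euc n)) (T : 𝓓'(X, ℝ)) : Prop :=
  ∀ A ∈ polarCone P, ∀ φ : 𝓓(X, ℝ), (∀ x, 0 ≤ φ x) → 0 ≤ distLaplacian A T φ

/-- `f ∈ USC(S)`: on `S`, `f` is upper semicontinuous with values in `[-∞, ∞)`, and it is not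
identically `-∞` on any connected component of `S`. -/
structure IsUSC {α : Type*} [TopologicalSpace α] (S : Set α) (f : α → EReal) : Prop where
  usc : UpperSemicontinuousOn f S
  ne_top : ∀ x ∈ S, f x ≠ ⊤
  ne_bot : ∀ x ∈ S, ∃ y ∈ connectedComponentIn S x, f y ≠ ⊥

/-- The essential limit superior `ess limsup_{y → x} f y`. -/
def essLimsup {n : ℕ} (f : Euc n → ℝ) (x : Euc n) : EReal :=
  limsup (fun y => (f y : EReal)) (𝓝 x ⊓ ae volume)

/-- `f` is `L¹_loc`-upper-semicontinuous on `X`: it is locally integrable, its essential limit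
superior is in `USC(X)` and lies in the `L¹_loc(X)`-class of `f`. -/
structure IsL1locUSC {n : ℕ} (X : Set (Euc n)) (f : Euc n → ℝ) : Prop where
  locallyIntegrableOn : LocallyIntegrableOn f X
  isUSC : IsUSC X (essLimsup f)
  ae_eq : ∀ᵐ x ∂volume.restrict X, essLimsup f x = (f x : EReal)

/-- `u ∈ PSH^{u.s.c.}(X)`: `u` is the canonical upper semicontinuous representative of a
`P`-plurisubharmonic distribution `T` on `X`, that is, `T` is given by an
`L¹_loc`-upper-semicontinuous function `f` and `u` is the essential limit superior of `f`. -/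
def IsUSCPsh {n : ℕ} (P : Set (Euc n →L[ℝ] Euc n)) (X : TopologicalSpace.Opens (Euc n))
    (u : Euc n → EReal) : Prop :=
  ∃ T : 𝓓'(X, ℝ), IsPshDistribution P T ∧
    ∃ f : Euc n → ℝ, IsL1locUSC (X : Set (Euc n)) f ∧
      (∀ φ : 𝓓(X, ℝ), T φ = ∫ x, f x * φ x) ∧ ∀ x ∈ X, u x = essLimsup f x

/-! ### Subharmonic functions on open subsets of a Euclidean space -/

/-- `v` is subharmonic on the open subset `U` of the Euclidean space `F`: `v ∈ USC(U)`, and for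
every compact `K ⊆ U` and every function `h` harmonic on a neighbourhood of `K`,
`v ≤ h` on `∂K` implies `v ≤ h` on `K`. -/
structure IsSubharmonicOn {F : Type*} [NormedAddCommGroup F] [InnerProductSpace ℝ F]
    [FiniteDimensional ℝ F] (U : Set F) (v : F → EReal) : Prop where
  isUSC : IsUSC U v
  le_of_frontier : ∀ K : Set F, IsCompact K → K ⊆ U →
    ∀ h : F → ℝ, InnerProductSpace.HarmonicOnNhd h K →
      (∀ x ∈ frontier K, v x ≤ (h x : EReal)) → ∀ x ∈ K, v x ≤ (h x : EReal)

/-! ### Riemannian geometry in coordinates -/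

/-- The partial derivative `∂ᵢ f`. -/
def pderivE {p : ℕ} {F : Type*} [NormedAddCommGroup F] [NormedSpace ℝ F] (i : Fin p)
    (f : Euc p → F) (y : Euc p) : F :=
  fderiv ℝ f y (EuclideanSpace.single i 1)

/-- The Christoffel symbol `Γᵏᵢⱼ = ½ ∑ₗ gᵏˡ (∂ᵢ gⱼₗ + ∂ⱼ gᵢₗ - ∂ₗ gᵢⱼ)` of a metric `g`. -/
def christoffel {p : ℕ} (g : Euc p → Matrix (Fin p) (Fin p) ℝ) (k i j : Fin p) (y : Euc p) : ℝ :=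
  (1 / 2) * ∑ l : Fin p, (g y)⁻¹ k l *
    (pderivE i (fun z => g z j l) y + pderivE j (fun z => g z i l) y
      - pderivE l (fun z => g z i j) y)

/-- The Laplace-Beltrami operator of a metric `g`, the trace of the covariant Hessian:
`Δ f = ∑ᵢⱼ gⁱʲ (∂ᵢ ∂ⱼ f - ∑ₖ Γᵏᵢⱼ ∂ₖ f)`. -/
def laplaceBeltramiCoord {p : ℕ} (g : Euc p → Matrix (Fin p) (Fin p) ℝ) (f : Euc p → ℝ)
    (y : Euc p) : ℝ :=
  ∑ i : Fin p, ∑ j : Fin p, (g y)⁻¹ i j *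
    (pderivE i (pderivE j f) y - ∑ k : Fin p, christoffel g k i j y * pderivE k f y)

/-! ### Submanifolds of `ℝⁿ`

A `p`-dimensional submanifold of `ℝⁿ` is a smooth `p`-manifold `M` together with a smooth
immersion `ι : M → ℝⁿ` (for an embedded submanifold, `M` is a subset of `ℝⁿ` and `ι` is the
inclusion). The geometric quantities at `m` are computed in the preferred chart at `m`; they do
not depend on the chart. -/

section Submanifold

variable {n : ℕ} (p : ℕ) {M : Type*} [TopologicalSpace M] [ChartedSpace (Euc p) M]

/-- The differential of `ι` at `m`, as a linear map `T_m M = ℝᵖ → ℝⁿ`. -/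
def differential (ι : M → Euc n) (m : M) : Euc p →L[ℝ] Euc n :=
  mfderiv (𝓡 p) 𝓘(ℝ, Euc n) ι m

/-- `ι` is a smooth immersion of `M` into `ℝⁿ`. -/
structure IsImmersedSubmanifold (ι : M → Euc n) : Prop where
  contMDiff : ContMDiff (𝓡 p) 𝓘(ℝ, Euc n) ∞ ι
  injective_differential : ∀ m : M, Function.Injective (differential p ι m)

/-- The tangent plane `T_m M ⊆ ℝⁿ`. -/
def tangentPlane (ι : M → Euc n) (m : M) : Submodule ℝ (Euc n) :=
  LinearMap.range (differential p ι m : Euc p →ₗ[ℝ] Euc n)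

/-- The local parametrization of the submanifold given by the preferred chart at `m`. -/
def localParam (ι : M → Euc n) (m : M) : Euc p → Euc n :=
  ι ∘ (chartAt (Euc p) m).symm

/-- The induced metric `gᵢⱼ = ⟪∂ᵢ ψ, ∂ⱼ ψ⟫` in the preferred chart at `m`. -/
def inducedMetric (ι : M → Euc n) (m : M) (y : Euc p) : Matrix (Fin p) (Fin p) ℝ :=
  Matrix.of fun i j => ⟪pderivE i (localParam p ι m) y, pderivE j (localParam p ι m) y⟫_ℝ

/-- The Laplace-Beltrami operator of the induced metric on `M`, at the point `m`. -/
def laplaceBeltrami (ι : M → Euc n) (h : M → ℝ) (m : M) : ℝ :=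
  laplaceBeltramiCoord (inducedMetric p ι m) (h ∘ (chartAt (Euc p) m).symm)
    (chartAt (Euc p) m m)

/-- The value `II(∂ᵢ, ∂ⱼ) = (∂ᵢ ∂ⱼ ψ)^⊥` of the second fundamental form at `m`. -/
def secondFundForm (ι : M → Euc n) (m : M) (i j : Fin p) : Euc n :=
  (tangentPlane p ι m)ᗮ.starProjection
    (pderivE i (pderivE j (localParam p ι m)) (chartAt (Euc p) m m))

/-- The mean curvature vector at `m`, the trace `∑ᵢⱼ gⁱʲ II(∂ᵢ, ∂ⱼ)` of the second fundamental
form. -/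
def meanCurvature (ι : M → Euc n) (m : M) : Euc n :=
  ∑ i : Fin p, ∑ j : Fin p, (inducedMetric p ι m (chartAt (Euc p) m m))⁻¹ i j •
    secondFundForm p ι m i j

/-- The submanifold is minimal: its mean curvature vanishes identically. -/
def IsMinimalSubmanifold (ι : M → Euc n) : Prop :=
  ∀ m : M, meanCurvature p ι m = 0

/-- `h` is harmonic near `m` for the induced metric. -/
def IsHarmonicNear (ι : M → Euc n) (h : M → ℝ) (m : M) : Prop :=
  ContMDiffAt (𝓡 p) 𝓘(ℝ, ℝ) 2 h m ∧ ∀ᶠ m' in 𝓝 m, laplaceBeltrami p ι h m' = 0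

/-- `v` is subharmonic on `M` for the induced metric: `v ∈ USC(M)`, and for every compact
`K ⊆ M` and every function `h` harmonic on a neighbourhood of `K`, `v ≤ h` on `∂K` implies
`v ≤ h` on `K`. -/
structure IsSubharmonicInduced (ι : M → Euc n) (v : M → EReal) : Prop where
  isUSC : IsUSC univ v
  le_of_frontier : ∀ K : Set M, IsCompact K →
    ∀ h : M → ℝ, (∀ m ∈ K, IsHarmonicNear p ι h m) →
      (∀ m ∈ frontier K, v m ≤ (h m : EReal)) → ∀ m ∈ K, v m ≤ (h m : EReal)

end Submanifold

end

/-! The core is a comparison principle: smooth majorants of `u` reduce the claim to a maximum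
principle for smooth functions.

Ellipticity provides a positive definite `A` in the cone `𝒫₊(G)`, and the distribution is
subharmonic for `Δ_A`. Convolve `f` with dilates `rⁿ ρ(r ·)` of a kernel satisfying `Δ_A η = -(n ρ +
y · ∇ρ)` for some `η ≥ 0` (`exists_mollifier`). The `r`-derivative of the mollification is then
minus a nonnegative multiple of a pairing of `f` with `Δ_A` of a nonnegative bump, so mollifications
decrease in `r` (`mollify_antitone`). As they converge almost everywhere to `f`, each lies above the
essential limsup at every point, not merely almost everywhere. This is what allows restriction to
null sets such as planes and submanifolds. The mollifications are also smooth, have nonnegative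
trace of the Hessian along each plane of `G`, and are bounded by upper bounds of `u` on small balls
(`IsUSCPsh.exists_smooth_majorants`).

Given `h` harmonic with `u ≤ h` on the frontier of `K`, upper semicontinuity and compactness give `v
r < h + δ` there for large `r`. Adding `ε ‖x‖²` makes the majorant strictly plurisubharmonic, so its
difference with `h` has no interior maximum; let `δ → 0` (`IsUSCPsh.le_of_le_frontier`).

The last ingredient is that the Laplacian of `v` restricted to `M` is the trace of `D²v` along the
tangent plane plus `dv` of the mean curvature vector (`laplaceBeltramiCoord_comp`). Minimality kills
the second term; on an affine plane there is none. -/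

noncomputable section

/-! ### Second directional derivatives -/

section SecondDerivatives

variable {E : Type*} [NormedAddCommGroup E] [NormedSpace ℝ E]
  {F : Type*} [NormedAddCommGroup F] [NormedSpace ℝ F]

/-- The second directional derivative `D²v(x)(a, b)`. -/
def hess (v : E → F) (x a b : E) : F :=
  fderiv ℝ (fun y => fderiv ℝ v y b) x a

theorem ContDiffAt.differentiableAt_fderiv {v : E → F} {x : E} (hv : ContDiffAt ℝ 2 v x) :
    DifferentiableAt ℝ (fderiv ℝ v) x :=
  (hv.fderiv_right (m := 1) (by norm_num)).differentiableAt (by norm_num)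

theorem hess_eq {v : E → F} {x : E} (hv : ContDiffAt ℝ 2 v x) (a b : E) :
    hess v x a b = fderiv ℝ (fderiv ℝ v) x a b := by
  unfold hess
  rw [fderiv_clm_apply hv.differentiableAt_fderiv (differentiableAt_const b)]
  simp

theorem hess_symm {v : E → F} {x : E} (hv : ContDiffAt ℝ 2 v x) (a b : E) :
    hess v x a b = hess v x b a := by
  rw [hess_eq hv, hess_eq hv]
  exact (hv.isSymmSndFDerivAt (by simp)) a b

theorem eventually_differentiableAt {v : E → F} {x : E} (hv : ContDiffAt ℝ 2 v x) :
    ∀ᶠ y in 𝓝 x, DifferentiableAt ℝ v y :=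
  (hv.eventually (by simp)).mono fun _ h => h.differentiableAt (by norm_num)

theorem hess_add {v w : E → F} {x : E} (hv : ContDiffAt ℝ 2 v x) (hw : ContDiffAt ℝ 2 w x)
    (a b : E) : hess (fun y => v y + w y) x a b = hess v x a b + hess w x a b := by
  unfold hess
  have : (fun y => fderiv ℝ (fun y => v y + w y) y b) =ᶠ[𝓝 x]
      fun y => fderiv ℝ v y b + fderiv ℝ w y b := by
    filter_upwards [eventually_differentiableAt hv, eventually_differentiableAt hw] with y h1 h2
    rw [fderiv_fun_add h1 h2]; rfl
  rw [this.fderiv_eq, fderiv_fun_add]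
  · rfl
  · exact hv.differentiableAt_fderiv.clm_apply (differentiableAt_const b)
  · exact hw.differentiableAt_fderiv.clm_apply (differentiableAt_const b)

theorem hess_const_smul {v : E → F} {x : E} (hv : ContDiffAt ℝ 2 v x) (c : ℝ)
    (a b : E) : hess (fun y => c • v y) x a b = c • hess v x a b := by
  unfold hess
  have : (fun y => fderiv ℝ (fun y => c • v y) y b) =ᶠ[𝓝 x]
      fun y => c • fderiv ℝ v y b := by
    filter_upwards [eventually_differentiableAt hv] with y h1
    rw [fderiv_fun_const_smul h1]; rfl
  rw [this.fderiv_eq, fderiv_fun_const_smul]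
  · rfl
  · exact hv.differentiableAt_fderiv.clm_apply (differentiableAt_const b)

/-- The second derivative test: necessary condition at a local maximum. -/
theorem IsLocalMax.hess_nonpos {v : E → ℝ} {x : E} (hmax : IsLocalMax v x)
    (hv : ContDiffAt ℝ 2 v x) (a : E) : hess v x a a ≤ 0 := by
  by_contra! hpos
  have hline : ∀ t : ℝ, HasDerivAt (fun t : ℝ => x + t • a) a t := fun t => by
    simpa using ((hasDerivAt_id t).smul_const a).const_add x
  have hcont : ContinuousAt (fun t : ℝ => x + t • a) 0 := (hline 0).continuousAt
  have htend : Tendsto (fun t : ℝ => x + t • a) (𝓝 0) (𝓝 x) := by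
    simpa [ContinuousAt] using hcont
  set φ : ℝ → ℝ := fun t => v (x + t • a) with hφ
  have hd : deriv φ =ᶠ[𝓝 0] fun t => fderiv ℝ v (x + t • a) a := by
    filter_upwards [htend.eventually (eventually_differentiableAt hv)] with t ht
    exact (ht.hasFDerivAt.comp_hasDerivAt t (hline t)).deriv
  have hdd : deriv (deriv φ) 0 = hess v x a a := by
    rw [hd.deriv_eq]
    have h1 : DifferentiableAt ℝ (fun y => fderiv ℝ v y a) (x + (0 : ℝ) • a) := by
      rw [zero_smul, add_zero]
      exact hv.differentiableAt_fderiv.clm_apply (differentiableAt_const a)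
    have := (h1.hasFDerivAt.comp_hasDerivAt (0 : ℝ) (hline 0)).deriv
    simpa [hess, Function.comp_def] using this
  have hlm : IsLocalMax φ 0 := by
    have := htend.eventually hmax
    simpa [IsLocalMax, IsMaxFilter, hφ] using this
  have hφc : ContinuousAt φ 0 := by
    have h1 : ContinuousAt v (x + (0 : ℝ) • a) := by simpa using hv.continuousAt
    exact ContinuousAt.comp (f := fun t : ℝ => x + t • a) h1 hcont
  -- A positive second derivative at the critical point makes `0` a local minimum of `φ` as well;
  -- `φ` is then locally constant, so its second derivative vanishes.
  have hmin := isLocalMin_of_deriv_deriv_pos (hdd ▸ hpos) hlm.deriv_eq_zero hφc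
  have hconst : φ =ᶠ[𝓝 0] fun _ => φ 0 := by
    filter_upwards [hmin, hlm] with t h1 h2 using le_antisymm h2 h1
  have h0 : deriv φ =ᶠ[𝓝 0] fun _ => 0 := by
    filter_upwards [hconst.eventually_nhds] with t ht
    rw [Filter.EventuallyEq.deriv_eq (f := fun _ => φ 0) ht]; simp
  rw [← hdd, h0.deriv_eq] at hpos
  simp at hpos

end SecondDerivatives

/-! ### Linear operators with constant coefficients -/

section ConstantCoefficients

variable {n : ℕ}

/-- The standard basis vector `eᵢ`. -/
abbrev stdVec (i : Fin n) : Euc n := EuclideanSpace.single i (1 : ℝ)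

/-- The operator `Δ_B v = ⟨Hess v, B⟩ = ∑ᵢⱼ Bᵢⱼ ∂ᵢ ∂ⱼ v`. -/
def constLaplacian (B : Euc n →L[ℝ] Euc n) (v : Euc n → ℝ) (x : Euc n) : ℝ :=
  ∑ i : Fin n, ∑ j : Fin n, B (stdVec j) i * hess v x (stdVec i) (stdVec j)

theorem testFunction_lineDeriv_apply {X : TopologicalSpace.Opens (Euc n)} (ψ : 𝓓(X, ℝ))
    (a x : Euc n) : (∂_{a} ψ) x = fderiv ℝ ψ x a := by
  rw [TestFunction.lineDerivOp_eq_lineDerivCLM ℝ, TestFunction.lineDerivCLM_eq_fderivCLM,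
    TestFunction.fderivCLM_apply_of_le ψ (by simp)]

theorem testFunction_lineDeriv_lineDeriv_apply {X : TopologicalSpace.Opens (Euc n)} (ψ : 𝓓(X, ℝ))
    (a b x : Euc n) : (∂_{a} (∂_{b} ψ)) x = hess ψ x a b := by
  rw [testFunction_lineDeriv_apply]
  have : (⇑(∂_{b} ψ : 𝓓(X, ℝ)) : Euc n → ℝ) = fun y => fderiv ℝ ψ y b := by
    ext y; rw [testFunction_lineDeriv_apply]
  rw [this]; rfl

/-- Two integrations by parts move both derivatives onto the test function and their signs cancel.
They arrive in reversed order, which the symmetry of the Hessian repairs. -/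
theorem IsPshDistribution.integral_nonneg {X : TopologicalSpace.Opens (Euc n)}
    {P : Set (Euc n →L[ℝ] Euc n)} {T : 𝓓'(X, ℝ)} (hT : IsPshDistribution P T)
    {f : Euc n → ℝ} (hf : ∀ φ : 𝓓(X, ℝ), T φ = ∫ x, f x * φ x)
    {B : Euc n →L[ℝ] Euc n} (hB : B ∈ polarCone P) {φ : Euc n → ℝ} (hφ : ContDiff ℝ ∞ φ)
    (hc : HasCompactSupport φ) (hX : tsupport φ ⊆ X) (h0 : ∀ x, 0 ≤ φ x) :
    0 ≤ ∫ x, f x * constLaplacian B φ x := by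
  let ψ : 𝓓(X, ℝ) := ⟨φ, hφ, hc, hX⟩
  have h := hT B hB ψ h0
  have h1 : distLaplacian B T ψ = T (∑ i : Fin n, ∑ j : Fin n, (B (stdVec j) i) •
      ∂_{stdVec j} (∂_{stdVec i} ψ)) := by
    unfold distLaplacian
    simp only [map_sum, map_smul, sum_apply, smul_apply,
      Distribution.lineDerivOp_apply_apply, map_neg, neg_neg]
  rw [h1, hf] at h
  convert h using 3 with x
  congr 1
  simp only [sum_apply, smul_apply, testFunction_lineDeriv_lineDeriv_apply, smul_eq_mul]
  refine Finset.sum_congr rfl fun i _ => Finset.sum_congr rfl fun j _ => ?_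
  congr 1
  exact hess_symm (hφ.contDiffAt.of_le ENat.LEInfty.out) _ _

end ConstantCoefficients

/-! ### A mollifier adapted to a positive definite operator -/

section Mollifier

variable {n : ℕ}

theorem apply_eq_sum_stdVec {F : Type*} [NormedAddCommGroup F] [NormedSpace ℝ F]
    (A : Euc n →L[ℝ] F) (z : Euc n) : A z = ∑ j, z j • A (stdVec j) := by
  have h : z = ∑ j, z j • stdVec j := by
    simpa using ((EuclideanSpace.basisFun (Fin n) ℝ).sum_repr z).symm
  conv_lhs => rw [h]
  simp

theorem apply_coord_eq_sum (A : Euc n →L[ℝ] Euc n) (z : Euc n) (i : Fin n) :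
    ∑ j, A (stdVec j) i * z j = A z i := by
  rw [apply_eq_sum_stdVec A z]
  simp [mul_comm]

/-- A positive definite operator has an inverse, up to a factor, that dominates the identity. -/
theorem exists_scaled_inverse {A : Euc n →L[ℝ] Euc n} (hA : IsSelfAdjoint A)
    (hpos : ∀ x, x ≠ 0 → 0 < ⟪A x, x⟫_ℝ) :
    ∃ L : ℝ, 0 < L ∧ ∃ B : Euc n →L[ℝ] Euc n, (∀ y, A (B y) = L • y) ∧
      (∀ x y, ⟪B x, y⟫_ℝ = ⟪x, B y⟫_ℝ) ∧ ∀ y, ‖y‖ ^ 2 ≤ ⟪B y, y⟫_ℝ := by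
  have hsymm : ∀ x y, ⟪A x, y⟫_ℝ = ⟪x, A y⟫_ℝ := fun x y => by
    rw [← ContinuousLinearMap.adjoint_inner_right, ContinuousLinearMap.isSelfAdjoint_iff'.1 hA]
  have hinj : Function.Injective (A : Euc n →ₗ[ℝ] Euc n) := by
    rw [← LinearMap.ker_eq_bot, LinearMap.ker_eq_bot']
    intro x hx
    by_contra h
    have := hpos x h
    rw [show A x = 0 from hx] at this
    simp at this
  let e := LinearEquiv.ofInjectiveEndo (A : Euc n →ₗ[ℝ] Euc n) hinj
  let C : Euc n →L[ℝ] Euc n := LinearMap.toContinuousLinearMap (e.symm : Euc n →ₗ[ℝ] Euc n)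
  have hAC : ∀ y, A (C y) = y := fun y => e.apply_symm_apply y
  have hCsymm : ∀ x y, ⟪C x, y⟫_ℝ = ⟪x, C y⟫_ℝ := fun x y => by
    rw [← hAC y, ← hsymm, hAC, hAC]
  have hCpos : ∀ y, y ≠ 0 → 0 < ⟪C y, y⟫_ℝ := fun y hy => by
    have hne : C y ≠ 0 := fun h => hy (by rw [← hAC y, h, map_zero])
    have := hpos _ hne
    rwa [hAC, real_inner_comm] at this
  obtain ⟨L, hL, hbound⟩ : ∃ L : ℝ, 0 < L ∧ ∀ y, ‖y‖ ^ 2 ≤ L * ⟪C y, y⟫_ℝ := by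
    -- The unit sphere is empty when `n = 0`. Otherwise `L` is the reciprocal of the minimum on it
    -- of the quadratic form of `A⁻¹`.
    rcases (Metric.sphere (0 : Euc n) 1).eq_empty_or_nonempty with hS | hS
    · refine ⟨1, one_pos, fun y => ?_⟩
      have hy : y = 0 := by
        by_contra h
        have : (‖y‖⁻¹ • y) ∈ Metric.sphere (0 : Euc n) 1 := by
          simp [norm_smul, norm_ne_zero_iff.2 h]
        rw [hS] at this
        exact this
      simp [hy]
    · obtain ⟨y₀, hy₀, hmin⟩ := (isCompact_sphere (0 : Euc n) 1).exists_isMinOn hS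
        (f := fun y => ⟪C y, y⟫_ℝ) (by fun_prop)
      have hy₀' : y₀ ≠ 0 := by
        rintro rfl; simp at hy₀
      have hc := hCpos y₀ hy₀'
      refine ⟨(⟪C y₀, y₀⟫_ℝ)⁻¹, inv_pos.2 hc, fun y => ?_⟩
      by_cases h : y = 0
      · simp [h]
      have hn : 0 < ‖y‖ := norm_pos_iff.2 h
      have h1 : (‖y‖⁻¹ • y) ∈ Metric.sphere (0 : Euc n) 1 := by
        simp [norm_smul, norm_ne_zero_iff.2 h]
      have h2 : ⟪C y₀, y₀⟫_ℝ ≤ ⟪C (‖y‖⁻¹ • y), ‖y‖⁻¹ • y⟫_ℝ := hmin h1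
      rw [map_smul, real_inner_smul_left, real_inner_smul_right] at h2
      rw [le_inv_mul_iff₀ hc]
      calc ⟪C y₀, y₀⟫_ℝ * ‖y‖ ^ 2 ≤ (‖y‖⁻¹ * (‖y‖⁻¹ * ⟪C y, y⟫_ℝ)) * ‖y‖ ^ 2 := by gcongr
        _ = ⟪C y, y⟫_ℝ := by field_simp
  refine ⟨L, hL, L • C, fun y => ?_, fun x y => ?_, fun y => ?_⟩
  · simp [hAC]
  · simp [real_inner_smul_left, real_inner_smul_right, hCsymm]
  · simpa [real_inner_smul_left] using hbound y

/-- The kernel is built from this derivative; a point where it is positive ensures that the kernel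
has positive mass and can be normalized. -/
theorem exists_deriv_expNegInvGlue_pos :
    ∃ t ∈ Ioo (0 : ℝ) 1, 0 < deriv expNegInvGlue t := by
  have hd : Differentiable ℝ expNegInvGlue := expNegInvGlue.contDiff.differentiable (n := 1) (by simp)
  obtain ⟨t, ht, h⟩ := exists_deriv_eq_slope expNegInvGlue (a := 0) (b := 1) one_pos
    hd.continuous.continuousOn hd.differentiableOn
  refine ⟨t, ht, ?_⟩
  rw [h, expNegInvGlue.zero]
  simpa using expNegInvGlue.pos_of_pos one_pos

/-- For a positive definite `A` there is a mollifier `ρ` whose dilates are differentiated, with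
respect to the scale, by `Δ_A` of a nonnegative function. -/
theorem exists_mollifier (hn : 0 < n) {A : Euc n →L[ℝ] Euc n} (hA : IsSelfAdjoint A)
    (hpos : ∀ x, x ≠ 0 → 0 < ⟪A x, x⟫_ℝ) :
    ∃ η ρ : Euc n → ℝ, ContDiff ℝ ∞ η ∧ ContDiff ℝ ∞ ρ ∧ (∀ y, 0 ≤ η y) ∧ (∀ y, 0 ≤ ρ y) ∧
      tsupport η ⊆ Metric.closedBall 0 1 ∧ tsupport ρ ⊆ Metric.closedBall 0 1 ∧ ∫ y, ρ y = 1 ∧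
      ∀ y, constLaplacian A η y = -(n * ρ y + fderiv ℝ ρ y y) := by
  obtain ⟨L, hL, B, hAB, hsymm, hB⟩ := exists_scaled_inverse hA hpos
  have hBq : ContDiff ℝ ∞ (fun y : Euc n => ⟪B y, y⟫_ℝ) := B.contDiff.inner ℝ contDiff_id
  have hqd : ∀ y z, fderiv ℝ (fun y : Euc n => ⟪B y, y⟫_ℝ) y z = 2 * ⟪B y, z⟫_ℝ := fun y z => by
    have h := fderiv_inner_apply ℝ (B.differentiableAt (x := y)) differentiableAt_fun_id z
    rw [h]
    simp only [fderiv_fun_id, ContinuousLinearMap.fderiv, ContinuousLinearMap.id_apply]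
    rw [hsymm z y, real_inner_comm]
    ring
  have hE : ContDiff ℝ ∞ expNegInvGlue := expNegInvGlue.contDiff (n := ⊤)
  have hE' : ContDiff ℝ ∞ (deriv expNegInvGlue) := (contDiff_infty_iff_deriv.1 hE).2
  have hd : Differentiable ℝ expNegInvGlue := hE.differentiable (by simp)
  -- `q` is the quadratic form of a multiple of `A⁻¹`. The factor `2` in `σ` is chosen so that `∇η =
  -- -σ B y`; since `‖y‖² ≤ q y`, both `η` and `σ` vanish outside the unit ball.
  set q : Euc n → ℝ := fun y => ⟪B y, y⟫_ℝ with hq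
  set η : Euc n → ℝ := fun y => expNegInvGlue (1 - q y) with hη
  set σ : Euc n → ℝ := fun y => 2 * deriv expNegInvGlue (1 - q y) with hσ
  have hηs : ContDiff ℝ ∞ η := hE.comp (contDiff_const.sub hBq)
  have hσs : ContDiff ℝ ∞ σ := contDiff_const.mul (hE'.comp (contDiff_const.sub hBq))
  have hσ0 : ∀ y, 0 ≤ σ y := fun y => mul_nonneg zero_le_two (expNegInvGlue.monotone.deriv_nonneg)
  have hsupp : ∀ y, y ∉ Metric.closedBall (0 : Euc n) 1 → 1 - q y < 0 := fun y hy => by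
    have h1 : 1 < ‖y‖ := by simpa using hy
    have := hB y
    have : q y = ⟪B y, y⟫_ℝ := rfl
    nlinarith
  have hηsupp : Function.support η ⊆ Metric.closedBall 0 1 := fun y hy => by
    by_contra h
    exact hy (expNegInvGlue.zero_of_nonpos (hsupp y h).le)
  have hσsupp : Function.support σ ⊆ Metric.closedBall 0 1 := fun y hy => by
    by_contra h
    refine hy ?_
    have : expNegInvGlue =ᶠ[𝓝 (1 - q y)] fun _ => 0 := by
      filter_upwards [Iio_mem_nhds (hsupp y h)] with t ht using
        expNegInvGlue.zero_of_nonpos (le_of_lt ht)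
    simp [hσ, this.deriv_eq]
  have hclosed {g : Euc n → ℝ} (h : Function.support g ⊆ Metric.closedBall 0 1) :
      tsupport g ⊆ Metric.closedBall 0 1 := closure_minimal h Metric.isClosed_closedBall
  have hσcs : HasCompactSupport σ :=
    HasCompactSupport.intro (isCompact_closedBall 0 1) fun y hy => by
      by_contra h; exact hy (hσsupp h)
  have hfd : ∀ y z, fderiv ℝ η y z = -(σ y * ⟪B y, z⟫_ℝ) := fun y z => by
    have h1 : DifferentiableAt ℝ q y := hBq.differentiable (by simp) y
    have h2 := (hd (1 - q y)).hasDerivAt.comp_hasFDerivAt y (h1.hasFDerivAt.const_sub 1)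
    have h3 : fderiv ℝ η y = deriv expNegInvGlue (1 - q y) • -fderiv ℝ q y := h2.fderiv
    rw [h3]
    simp only [smul_apply, neg_apply, hqd, smul_eq_mul, hσ]
    ring
  have hhess : ∀ y a b, hess η y a b = -(fderiv ℝ σ y a * ⟪B y, b⟫_ℝ + σ y * ⟪B a, b⟫_ℝ) := by
    intro y a b
    have h1 : DifferentiableAt ℝ σ y := hσs.differentiable (by simp) y
    have h2 : HasFDerivAt (fun y => ⟪B y, b⟫_ℝ) ((innerSL ℝ b).comp B) y := by
      have := ((innerSL ℝ b).comp B).hasFDerivAt (x := y)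
      convert this using 2 with z
      simp [real_inner_comm]
    unfold hess
    simp_rw [hfd]
    have h3 : fderiv ℝ (fun y => -(σ y * ⟪B y, b⟫_ℝ)) y = _ := (h1.hasFDerivAt.mul h2).neg.fderiv
    rw [h3]
    simp [real_inner_comm]
    ring
  have hlap : ∀ y, constLaplacian A η y = -(L * (n * σ y + fderiv ℝ σ y y)) := by
    intro y
    have hin : ∀ z : Euc n, ∀ j, ⟪z, stdVec j⟫_ℝ = z j := fun z j => by
      simp [EuclideanSpace.inner_single_right]
    unfold constLaplacian
    simp_rw [hhess, hin]
    -- Since `A B = L`, contracting `∇σ ⊗ B y` with `A` gives `L (y · ∇σ)`, while `σ B` contributes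
    -- `L σ` for each `i`, hence `n L σ` in all.
    have h1 : ∀ i, ∑ j, A (stdVec j) i * -(fderiv ℝ σ y (stdVec i) * B y j + σ y * B (stdVec i) j)
        = -(fderiv ℝ σ y (stdVec i) * (L * y i)) - σ y * L := by
      intro i
      have e1 := apply_coord_eq_sum A (B y) i
      have e2 := apply_coord_eq_sum A (B (stdVec i)) i
      rw [hAB] at e1 e2
      simp only [PiLp.smul_apply, smul_eq_mul, PiLp.single_apply, if_true, mul_one] at e1 e2
      rw [← e1]
      conv_rhs => rw [← e2]
      rw [Finset.mul_sum, Finset.mul_sum, ← Finset.sum_neg_distrib, ← Finset.sum_sub_distrib]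
      exact Finset.sum_congr rfl fun j _ => by ring
    simp_rw [h1]
    rw [apply_eq_sum_stdVec (fderiv ℝ σ y) y]
    simp only [Finset.sum_sub_distrib, Finset.sum_const, Finset.card_univ, Fintype.card_fin,
      smul_eq_mul, nsmul_eq_mul, Finset.sum_neg_distrib]
    have h2 : ∑ i, fderiv ℝ σ y (stdVec i) * (L * y i)
        = L * ∑ i, y i * fderiv ℝ σ y (stdVec i) := by
      rw [Finset.mul_sum]; exact Finset.sum_congr rfl fun j _ => by ring
    rw [h2]; ring
  have hσint : 0 < ∫ y, σ y := by
    obtain ⟨t, ht, htpos⟩ := exists_deriv_expNegInvGlue_pos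
    -- Scaling a nonzero vector reaches the level of `q` where `σ` is positive; a nonzero vector
    -- exists because `0 < n`.
    obtain ⟨y, hy⟩ : ∃ y, q y = 1 - t := by
      have he : stdVec (⟨0, hn⟩ : Fin n) ≠ 0 := by simp
      set e := stdVec (⟨0, hn⟩ : Fin n)
      have hqe : 0 < q e := lt_of_lt_of_le (by positivity) (hB e)
      refine ⟨Real.sqrt ((1 - t) / q e) • e, ?_⟩
      have : q (Real.sqrt ((1 - t) / q e) • e) = Real.sqrt ((1 - t) / q e) ^ 2 * q e := by
        simp only [hq, map_smul, real_inner_smul_left, real_inner_smul_right]; ring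
      rw [this, Real.sq_sqrt (div_nonneg (by linarith [ht.2]) hqe.le)]
      field_simp
    refine hσs.continuous.integral_pos_of_hasCompactSupport_nonneg_nonzero hσcs hσ0 (x := y) ?_
    simp only [hσ, hy, sub_sub_cancel]
    positivity
  set c := L * ∫ y, σ y with hc
  have hcpos : 0 < c := mul_pos hL hσint
  refine ⟨fun y => c⁻¹ * η y, fun y => c⁻¹ * (L * σ y), contDiff_const.mul hηs,
    contDiff_const.mul (contDiff_const.mul hσs), fun y => ?_, fun y => ?_, ?_, ?_, ?_, fun y => ?_⟩
  · exact mul_nonneg (inv_nonneg.2 hcpos.le) (expNegInvGlue.nonneg _)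
  · exact mul_nonneg (inv_nonneg.2 hcpos.le) (mul_nonneg hL.le (hσ0 y))
  · exact hclosed fun y hy => hηsupp fun h => hy (by simp [h])
  · exact hclosed fun y hy => hσsupp fun h => hy (by simp [h])
  · rw [integral_const_mul, integral_const_mul, ← hc, inv_mul_cancel₀ hcpos.ne']
  · have h1 : constLaplacian A (fun y => c⁻¹ * η y) y = c⁻¹ * constLaplacian A η y := by
      unfold constLaplacian
      simp_rw [Finset.mul_sum]
      refine Finset.sum_congr rfl fun i _ => Finset.sum_congr rfl fun j _ => ?_
      have := hess_const_smul (hηs.contDiffAt.of_le ENat.LEInfty.out : ContDiffAt ℝ 2 η y) c⁻¹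
        (stdVec i) (stdVec j)
      simp only [smul_eq_mul] at this
      rw [this]; ring
    have h2 : fderiv ℝ (fun y => c⁻¹ * (L * σ y)) y y = c⁻¹ * (L * fderiv ℝ σ y y) := by
      have hσd : DifferentiableAt ℝ σ y := hσs.differentiable (by simp) y
      rw [fderiv_const_mul (hσd.const_mul L), fderiv_const_mul hσd]
      simp
    rw [h1, h2, hlap]; ring

end Mollifier

/-! ### Mollification of weakly plurisubharmonic functions -/

section Mollification

variable {n : ℕ}

/-- `f` satisfies `⟨Hess f, B⟩ ≥ 0` on `U` in the sense of distributions, for all `B ∈ C`. -/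
def IsWeaklyPsh (C : Set (Euc n →L[ℝ] Euc n)) (U : Set (Euc n)) (f : Euc n → ℝ) : Prop :=
  ∀ B ∈ C, ∀ φ : Euc n → ℝ, ContDiff ℝ ∞ φ → HasCompactSupport φ → tsupport φ ⊆ U →
    (∀ x, 0 ≤ φ x) → 0 ≤ ∫ x, f x * constLaplacian B φ x

/-- The mollification of `f` by the dilate `rⁿ ρ(r ·)` of `ρ`. -/
def mollify (ρ : Euc n → ℝ) (f : Euc n → ℝ) (r : ℝ) (x : Euc n) : ℝ :=
  ∫ z, f z * (r ^ n * ρ (r • (x - z)))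

theorem hess_comp_affine {g : Euc n → ℝ} (hg : ContDiff ℝ ∞ g) (w : Euc n) (c : ℝ)
    (z a b : Euc n) :
    hess (fun z => g (w + c • z)) z a b = c ^ 2 * hess g (w + c • z) a b := by
  have haff : ∀ z, HasFDerivAt (fun z : Euc n => w + c • z) (c • ContinuousLinearMap.id ℝ (Euc n)) z :=
    fun z => ((hasFDerivAt_id z).const_smul c).const_add w
  have h1 : ∀ z, fderiv ℝ (fun z => g (w + c • z)) z b = c * fderiv ℝ g (w + c • z) b := by
    intro z
    have hd : DifferentiableAt ℝ g (w + c • z) := hg.differentiable (by simp) _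
    have : fderiv ℝ (fun z => g (w + c • z)) z = _ := (hd.hasFDerivAt.comp z (haff z)).fderiv
    rw [this]; simp
  have hd : DifferentiableAt ℝ (fun y => fderiv ℝ g y b) (w + c • z) :=
    (hg.contDiffAt.of_le ENat.LEInfty.out : ContDiffAt ℝ 2 g _).differentiableAt_fderiv.clm_apply
      (differentiableAt_const b)
  have h2 : fderiv ℝ (fun z => c * fderiv ℝ g (w + c • z) b) z = _ :=
    ((hd.hasFDerivAt.comp z (haff z)).const_mul c).fderiv
  unfold hess
  simp_rw [h1]
  rw [h2]
  simp
  ring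

theorem constLaplacian_comp_affine (B : Euc n →L[ℝ] Euc n) {g : Euc n → ℝ} (hg : ContDiff ℝ ∞ g)
    (w : Euc n) (c : ℝ) (z : Euc n) :
    constLaplacian B (fun z => g (w + c • z)) z = c ^ 2 * constLaplacian B g (w + c • z) := by
  unfold constLaplacian
  simp_rw [hess_comp_affine hg, Finset.mul_sum]
  exact Finset.sum_congr rfl fun i _ => Finset.sum_congr rfl fun j _ => by ring

theorem hess_contDiff {g : Euc n → ℝ} (hg : ContDiff ℝ ∞ g) (a b : Euc n) :
    ContDiff ℝ ∞ (fun x => hess g x a b) := by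
  have h1 : ContDiff ℝ ∞ (fun y => fderiv ℝ g y b) :=
    (hg.fderiv_right (m := ∞) (by simp)).clm_apply contDiff_const
  exact (h1.fderiv_right (m := ∞) (by simp)).clm_apply contDiff_const

theorem tsupport_hess_subset (g : Euc n → ℝ) (a b : Euc n) :
    tsupport (fun x => hess g x a b) ⊆ tsupport g :=
  (tsupport_fderiv_apply_subset ℝ a).trans (tsupport_fderiv_apply_subset ℝ b)

theorem constLaplacian_continuous (B : Euc n →L[ℝ] Euc n) {g : Euc n → ℝ}
    (hg : ContDiff ℝ ∞ g) : Continuous (constLaplacian B g) :=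
  continuous_finsetSum _ fun _ _ => continuous_finsetSum _ fun _ _ =>
    continuous_const.mul (hess_contDiff hg _ _).continuous

theorem support_constLaplacian_subset (B : Euc n →L[ℝ] Euc n) (g : Euc n → ℝ) :
    Function.support (constLaplacian B g) ⊆ tsupport g := by
  intro x hx
  by_contra h
  refine hx (Finset.sum_eq_zero fun i _ => Finset.sum_eq_zero fun j _ => ?_)
  have : hess g x (stdVec i) (stdVec j) = 0 :=
    image_eq_zero_of_notMem_tsupport (f := fun x => hess g x (stdVec i) (stdVec j))
      fun h' => h (tsupport_hess_subset g _ _ h')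
  rw [this, mul_zero]

theorem hasCompactSupport_of_tsupport_subset_closedBall {g : Euc n → ℝ}
    (h : tsupport g ⊆ Metric.closedBall 0 1) : HasCompactSupport g :=
  (isCompact_closedBall (0 : Euc n) 1).of_isClosed_subset (isClosed_tsupport g) h

/-- Testing a weakly plurisubharmonic function against a rescaled bump. -/
theorem IsWeaklyPsh.integral_rescaled_nonneg {C : Set (Euc n →L[ℝ] Euc n)} {U : Set (Euc n)}
    {f : Euc n → ℝ} (hf : IsWeaklyPsh C U f) {B : Euc n →L[ℝ] Euc n} (hB : B ∈ C)
    {g : Euc n → ℝ} (hg : ContDiff ℝ ∞ g) (h0 : ∀ y, 0 ≤ g y)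
    (hs : tsupport g ⊆ Metric.closedBall 0 1) {r : ℝ} (hr : 0 < r) {x : Euc n}
    (hx : Metric.closedBall x r⁻¹ ⊆ U) :
    0 ≤ ∫ z, f z * constLaplacian B g (r • (x - z)) := by
  have haff : ∀ z, r • (x - z) = r • x + (-r) • z := fun z => by rw [smul_sub, neg_smul]; abel
  have hsub : tsupport (fun z => g (r • x + (-r) • z)) ⊆ Metric.closedBall x r⁻¹ := by
    refine closure_minimal (fun z hz => ?_) Metric.isClosed_closedBall
    have h1 : r • (x - z) ∈ Metric.closedBall (0 : Euc n) 1 :=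
      hs (subset_tsupport g (by rw [haff]; exact hz))
    rw [mem_closedBall_zero_iff, norm_smul, Real.norm_of_nonneg hr.le] at h1
    rw [Metric.mem_closedBall, dist_comm, dist_eq_norm, ← one_div, le_div_iff₀ hr, mul_comm]
    exact h1
  have h := hf B hB (fun z => g (r • x + (-r) • z))
    (hg.comp (contDiff_const.add (contDiff_id.const_smul _)))
    ((isCompact_closedBall x r⁻¹).of_isClosed_subset (isClosed_tsupport _) hsub)
    (hsub.trans hx) fun z => h0 _
  simp_rw [constLaplacian_comp_affine B hg, neg_sq] at h
  have h2 : ∫ z, f z * (r ^ 2 * constLaplacian B g (r • x + (-r) • z))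
      = r ^ 2 * ∫ z, f z * constLaplacian B g (r • (x - z)) := by
    rw [← integral_const_mul]
    congr 1; ext z; rw [haff]; ring
  rw [h2] at h
  exact nonneg_of_mul_nonneg_right h (by positivity)

open scoped Convolution in
theorem fderiv_convolution_apply {f g : Euc n → ℝ} (hf : Integrable f) (hg : ContDiff ℝ ∞ g)
    (hc : HasCompactSupport g) (x b : Euc n) :
    fderiv ℝ (f ⋆[ContinuousLinearMap.mul ℝ ℝ] g) x b
      = (f ⋆[ContinuousLinearMap.mul ℝ ℝ] fun y => fderiv ℝ g y b) x := by
  rw [(hc.hasFDerivAt_convolution_right (ContinuousLinearMap.mul ℝ ℝ) hf.locallyIntegrable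
    (hg.of_le (by simp)) x).fderiv]
  exact convolution_precompR_apply _ hf.locallyIntegrable (hc.fderiv ℝ)
    (hg.continuous_fderiv (by simp)) x b

open scoped Convolution in
-- All derivatives fall on the smooth factor, so `f` need only be integrable.
theorem constLaplacian_convolution {f g : Euc n → ℝ} (hf : Integrable f) (hg : ContDiff ℝ ∞ g)
    (hc : HasCompactSupport g) (B : Euc n →L[ℝ] Euc n) (x : Euc n) :
    constLaplacian B (f ⋆[ContinuousLinearMap.mul ℝ ℝ] g) x
      = ∫ z, f z * constLaplacian B g (x - z) := by
  have hcs : ∀ b, HasCompactSupport (fun y => fderiv ℝ g y b) := fun b =>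
    hc.of_isClosed_subset (isClosed_tsupport _) (tsupport_fderiv_apply_subset ℝ b)
  have hcs2 : ∀ a b, HasCompactSupport (fun y => hess g y a b) := fun a b =>
    hc.of_isClosed_subset (isClosed_tsupport _) (tsupport_hess_subset g a b)
  have h1 : ∀ a b, hess (f ⋆[ContinuousLinearMap.mul ℝ ℝ] g) x a b = ∫ z, f z * hess g (x - z) a b := by
    intro a b
    unfold hess
    have : (fun y => fderiv ℝ (f ⋆[ContinuousLinearMap.mul ℝ ℝ] g) y b)
        = f ⋆[ContinuousLinearMap.mul ℝ ℝ] fun y => fderiv ℝ g y b := by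
      ext y; exact fderiv_convolution_apply hf hg hc y b
    rw [this, fderiv_convolution_apply hf
      ((hg.fderiv_right (m := ∞) (by simp)).clm_apply contDiff_const) (hcs b)]
    rfl
  have hint : ∀ a b, Integrable fun z => f z * hess g (x - z) a b := fun a b =>
    (hcs2 a b).convolutionExists_right (ContinuousLinearMap.mul ℝ ℝ) hf.locallyIntegrable
      (hess_contDiff hg a b).continuous x
  unfold constLaplacian
  simp_rw [h1, Finset.mul_sum, mul_left_comm (f _)]
  rw [integral_finsetSum _ fun i _ => integrable_finsetSum _ fun j _ => (hint _ _).const_mul _]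
  refine Finset.sum_congr rfl fun i _ => ?_
  rw [integral_finsetSum _ fun j _ => (hint _ _).const_mul _]
  exact Finset.sum_congr rfl fun j _ => (integral_const_mul _ _).symm

/-- The hypotheses on a mollifier, without its differential equation. -/
structure IsMollifier (ρ : Euc n → ℝ) : Prop where
  contDiff : ContDiff ℝ ∞ ρ
  nonneg : ∀ y, 0 ≤ ρ y
  tsupport_subset : tsupport ρ ⊆ Metric.closedBall 0 1
  integral_eq : ∫ y, ρ y = 1

namespace IsMollifier

variable {ρ : Euc n → ℝ}

theorem hasCompactSupport (hρ : IsMollifier ρ) : HasCompactSupport ρ :=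
  hasCompactSupport_of_tsupport_subset_closedBall hρ.tsupport_subset

theorem dilate_contDiff (hρ : IsMollifier ρ) (r : ℝ) : ContDiff ℝ ∞ fun w => r ^ n * ρ (r • w) :=
  contDiff_const.mul (hρ.contDiff.comp (contDiff_id.const_smul _))

theorem dilate_hasCompactSupport (hρ : IsMollifier ρ) {r : ℝ} (hr : 0 < r) :
    HasCompactSupport fun w => r ^ n * ρ (r • w) :=
  (hρ.hasCompactSupport.comp_smul hr.ne').mul_left

theorem dilate_eq_zero (hρ : IsMollifier ρ) {r : ℝ} (hr : 0 < r) {x z : Euc n} (h : z ∉ Metric.closedBall x r⁻¹) :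
    ρ (r • (x - z)) = 0 := by
  refine image_eq_zero_of_notMem_tsupport fun h1 => h ?_
  have h1 := hρ.tsupport_subset h1
  rw [mem_closedBall_zero_iff, norm_smul, Real.norm_of_nonneg hr.le] at h1
  rw [Metric.mem_closedBall, dist_comm, dist_eq_norm, ← one_div, le_div_iff₀ hr, mul_comm]
  exact h1

theorem integral_dilate (hρ : IsMollifier ρ) {r : ℝ} (hr : 0 < r) (x : Euc n) :
    ∫ z, r ^ n * ρ (r • (x - z)) = 1 := by
  rw [integral_const_mul, integral_sub_left_eq_self (fun z => ρ (r • z)),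
    Measure.integral_comp_smul, hρ.integral_eq, finrank_euclideanSpace_fin,
    abs_of_pos (by positivity)]
  simp [hr.ne']

open scoped Convolution in
theorem mollify_eq_convolution (ρ f : Euc n → ℝ) (r : ℝ) :
    mollify ρ f r = f ⋆[ContinuousLinearMap.mul ℝ ℝ] fun w => r ^ n * ρ (r • w) := rfl

theorem mollify_contDiff (hρ : IsMollifier ρ) {f : Euc n → ℝ} (hf : Integrable f) {r : ℝ} (hr : 0 < r) :
    ContDiff ℝ ∞ (mollify ρ f r) := by
  rw [mollify_eq_convolution]
  exact (hρ.dilate_hasCompactSupport hr).contDiff_convolution_right (n := ⊤) _ hf.locallyIntegrable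
    (hρ.dilate_contDiff r)

/-- Differentiating the kernel expresses the value at `x` as a positive multiple of `f` tested
against a rescaled `ρ`, whose support lies in the ball assumed to be inside `U`. -/
theorem constLaplacian_mollify_nonneg (hρ : IsMollifier ρ) {C : Set (Euc n →L[ℝ] Euc n)} {U : Set (Euc n)}
    {f : Euc n → ℝ} (hf : Integrable f) (hpsh : IsWeaklyPsh C U f) {B : Euc n →L[ℝ] Euc n}
    (hB : B ∈ C) {r : ℝ} (hr : 0 < r) {x : Euc n} (hx : Metric.closedBall x r⁻¹ ⊆ U) :
    0 ≤ constLaplacian B (mollify ρ f r) x := by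
  rw [mollify_eq_convolution, constLaplacian_convolution hf (hρ.dilate_contDiff r)
    (hρ.dilate_hasCompactSupport hr)]
  have h1 : ∀ w, constLaplacian B (fun w => r ^ n * ρ (r • w)) w
      = r ^ n * r ^ 2 * constLaplacian B ρ (r • w) := by
    intro w
    have h2 := constLaplacian_comp_affine B hρ.contDiff 0 r w
    simp only [zero_add] at h2
    rw [mul_assoc, ← h2]
    unfold constLaplacian
    simp_rw [Finset.mul_sum]
    refine Finset.sum_congr rfl fun i _ => Finset.sum_congr rfl fun j _ => ?_
    have hd : ContDiff ℝ ∞ fun w => ρ (r • w) :=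
      hρ.contDiff.comp (contDiff_id.const_smul _)
    have := hess_const_smul (hd.contDiffAt.of_le ENat.LEInfty.out : ContDiffAt ℝ 2 _ w) (r ^ n)
        (stdVec i) (stdVec j)
    simp only [smul_eq_mul] at this
    rw [this]; ring
  simp_rw [h1]
  have h3 : ∫ z, f z * (r ^ n * r ^ 2 * constLaplacian B ρ (r • (x - z)))
      = r ^ n * r ^ 2 * ∫ z, f z * constLaplacian B ρ (r • (x - z)) := by
    rw [← integral_const_mul]; congr 1; ext z; ring
  rw [h3]
  exact mul_nonneg (by positivity)
    (hpsh.integral_rescaled_nonneg hB hρ.contDiff hρ.nonneg hρ.tsupport_subset hr hx)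

/-- The mollification is an average of `f` against a probability density carried by that ball. -/
theorem mollify_le (hρ : IsMollifier ρ) {f : Euc n → ℝ} (hf : Integrable f) {r : ℝ} (hr : 0 < r) {x : Euc n} {c : ℝ}
    (h : ∀ᵐ z, z ∈ Metric.closedBall x r⁻¹ → f z ≤ c) : mollify ρ f r x ≤ c := by
  have hint : Integrable fun z => f z * (r ^ n * ρ (r • (x - z))) :=
    (hρ.dilate_hasCompactSupport hr).convolutionExists_right (ContinuousLinearMap.mul ℝ ℝ)
      hf.locallyIntegrable (hρ.dilate_contDiff r).continuous x
  have hint' : Integrable fun z => r ^ n * ρ (r • (x - z)) := by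
    by_contra h'
    have := hρ.integral_dilate hr x
    rw [integral_undef h'] at this
    exact zero_ne_one this
  calc mollify ρ f r x ≤ ∫ z, c * (r ^ n * ρ (r • (x - z))) := by
        refine integral_mono_ae hint (hint'.const_mul c) ?_
        filter_upwards [h] with z hz
        by_cases hzx : z ∈ Metric.closedBall x r⁻¹
        · exact mul_le_mul_of_nonneg_right (hz hzx) (mul_nonneg (by positivity) (hρ.nonneg _))
        · simp [hρ.dilate_eq_zero hr hzx]
    _ = c := by rw [integral_const_mul, hρ.integral_dilate hr, mul_one]

/-- Convergence holds at Lebesgue points: the kernels have mass one, live on shrinking balls, and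
are bounded by a constant over the volume of the ball. -/
theorem ae_tendsto_mollify (hρ : IsMollifier ρ) {f : Euc n → ℝ} (hf : Integrable f) :
    ∀ᵐ x, Tendsto (fun r => mollify ρ f r x) atTop (𝓝 (f x)) := by
  obtain ⟨M, hM⟩ := hρ.contDiff.continuous.bounded_above_of_compact_support hρ.hasCompactSupport
  filter_upwards [(Besicovitch.vitaliFamily (volume : Measure (Euc n))).ae_tendsto_average_norm_sub
    hf.locallyIntegrable] with x hx
  have hx' : Tendsto (fun r : ℝ => ⨍ y in Metric.closedBall x r⁻¹, ‖f y - f x‖) atTop (𝓝 0) :=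
    (hx.comp (Besicovitch.tendsto_filterAt volume x)).comp tendsto_inv_atTop_nhdsGT_zero
  have h := tendsto_integral_smul_of_tendsto_average_norm_sub (l := atTop)
    (g := fun (r : ℝ) z => r ^ n * ρ (r • (x - z)))
    -- The kernel is at most `M rⁿ`, which is this constant divided by the volume of the ball of
    -- radius `r⁻¹`.
    (M * (volume : Measure (Euc n)).real (Metric.ball 0 1)) hx'
    (Eventually.of_forall fun r => hf.integrableOn)
    (tendsto_const_nhds.congr' ((eventually_gt_atTop 0).mono fun r hr =>
      (hρ.integral_dilate hr x).symm))
    ((eventually_gt_atTop 0).mono fun r hr z hz => by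
      by_contra h'
      exact hz (by simp [hρ.dilate_eq_zero hr h']))
    ((eventually_gt_atTop 0).mono fun r hr z => by
      rw [Measure.addHaar_real_closedBall _ _ (inv_nonneg.2 hr.le), finrank_euclideanSpace_fin,
        abs_mul, abs_of_pos (pow_pos hr n)]
      have hv : 0 < (volume : Measure (Euc n)).real (Metric.ball 0 1) :=
        ENNReal.toReal_pos (Metric.measure_ball_pos _ _ one_pos).ne' measure_ball_lt_top.ne
      rw [mul_div_mul_right _ _ hv.ne', inv_pow, div_inv_eq_mul, mul_comm]
      exact mul_le_mul_of_nonneg_right (hM _) (pow_nonneg hr.le n))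
  refine h.congr fun r => ?_
  simp only [mollify, smul_eq_mul, mul_comm]

/-- Under the differential equation of `exists_mollifier`, mollifications of a weakly subharmonic
function are monotone in the scale. -/
theorem mollify_antitone (hρ : IsMollifier ρ) (hn : 0 < n) {C : Set (Euc n →L[ℝ] Euc n)} {U : Set (Euc n)}
    {f : Euc n → ℝ} (hf : Integrable f) (hpsh : IsWeaklyPsh C U f) {A : Euc n →L[ℝ] Euc n}
    (hA : A ∈ C) {η : Euc n → ℝ} (hη : ContDiff ℝ ∞ η) (hη0 : ∀ y, 0 ≤ η y)
    (hηs : tsupport η ⊆ Metric.closedBall 0 1)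
    (heq : ∀ y, constLaplacian A η y = -(n * ρ y + fderiv ℝ ρ y y))
    {R : ℝ} (hR : 0 < R) {x : Euc n} (hx : Metric.closedBall x R⁻¹ ⊆ U) :
    AntitoneOn (fun r => mollify ρ f r x) (Ici R) := by
  have hκ := constLaplacian_continuous A hη
  obtain ⟨M, hM⟩ := hκ.bounded_above_of_compact_support (HasCompactSupport.intro
    (isCompact_closedBall (0 : Euc n) 1) fun y hy => by
      by_contra h; exact hy (hηs (support_constLaplacian_subset A η h)))
  have hM0 : 0 ≤ M := (norm_nonneg _).trans (hM 0)
  have hker : ∀ w : Euc n, ∀ r : ℝ, HasDerivAt (fun r : ℝ => r ^ n * ρ (r • w))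
      (-(r ^ (n - 1) * constLaplacian A η (r • w))) r := by
    intro w r
    have h1 : HasDerivAt (fun r : ℝ => r • w) w r := by
      simpa using (hasDerivAt_id r).smul_const w
    have hd : DifferentiableAt ℝ ρ (r • w) := hρ.contDiff.differentiable (by simp) _
    refine ((hasDerivAt_pow n r).mul (hd.hasFDerivAt.comp_hasDerivAt r h1)).congr_deriv ?_
    rw [heq, map_smul, smul_eq_mul, Function.comp_apply]
    obtain ⟨m, rfl⟩ : ∃ m, n = m + 1 := ⟨n - 1, by omega⟩
    simp only [Nat.add_sub_cancel]
    ring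
  have hderiv : ∀ r : ℝ, 0 < r → HasDerivAt (fun r => mollify ρ f r x)
      (∫ z, f z * -(r ^ (n - 1) * constLaplacian A η (r • (x - z)))) r := by
    intro r hr
    refine (hasDerivAt_integral_of_dominated_loc_of_deriv_le (μ := volume)
      (F := fun r z => f z * (r ^ n * ρ (r • (x - z))))
      (F' := fun r z => f z * -(r ^ (n - 1) * constLaplacian A η (r • (x - z))))
      (bound := fun z => ‖f z‖ * ((2 * r) ^ (n - 1) * M)) (s := Ioo 0 (2 * r))
      (Ioo_mem_nhds hr (by linarith)) ?_ ?_ ?_ ?_ ?_ ?_).2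
    · refine Eventually.of_forall fun r => hf.aestronglyMeasurable.mul ?_
      have := hρ.contDiff.continuous
      exact Continuous.aestronglyMeasurable (by fun_prop)
    · exact (hρ.dilate_hasCompactSupport hr).convolutionExists_right (ContinuousLinearMap.mul ℝ ℝ)
        hf.locallyIntegrable (hρ.dilate_contDiff r).continuous x
    · exact hf.aestronglyMeasurable.mul (Continuous.aestronglyMeasurable (by fun_prop))
    · refine Eventually.of_forall fun z t ht => ?_
      rw [norm_mul, norm_neg, norm_mul, norm_pow, Real.norm_of_nonneg ht.1.le]
      have := ht.1.le
      gcongr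
      · exact ht.2.le
      · exact hM _
    · exact hf.norm.mul_const _
    · exact Eventually.of_forall fun z t _ => (hker (x - z) t).const_mul (f z)
  refine antitoneOn_of_deriv_nonpos (convex_Ici R)
    (fun r hr => (hderiv r (hR.trans_le hr)).continuousAt.continuousWithinAt)
    (fun r hr => (hderiv r (hR.trans_le (interior_subset hr))).differentiableAt.differentiableWithinAt)
    fun r hr => ?_
  have hRr : R ≤ r := interior_subset hr
  have hr0 := hR.trans_le hRr
  rw [(hderiv r hr0).deriv]
  have h3 : ∫ z, f z * -(r ^ (n - 1) * constLaplacian A η (r • (x - z)))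
      = -(r ^ (n - 1) * ∫ z, f z * constLaplacian A η (r • (x - z))) := by
    rw [← integral_const_mul, ← integral_neg]; congr 1; ext z; ring
  rw [h3, neg_nonpos]
  refine mul_nonneg (by positivity) (hpsh.integral_rescaled_nonneg hA hη hη0 hηs hr0
    ((Metric.closedBall_subset_closedBall ?_).trans hx))
  gcongr

/-- The canonical representative of a weakly subharmonic function lies below its mollifications. -/
theorem essLimsup_le_mollify (hρ : IsMollifier ρ) (hn : 0 < n) {C : Set (Euc n →L[ℝ] Euc n)} {U : Set (Euc n)}
    {f : Euc n → ℝ} (hf : Integrable f) (hpsh : IsWeaklyPsh C U f) {A : Euc n →L[ℝ] Euc n}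
    (hA : A ∈ C) {η : Euc n → ℝ} (hη : ContDiff ℝ ∞ η) (hη0 : ∀ y, 0 ≤ η y)
    (hηs : tsupport η ⊆ Metric.closedBall 0 1)
    (heq : ∀ y, constLaplacian A η y = -(n * ρ y + fderiv ℝ ρ y y))
    {R : ℝ} (hR : 0 < R) {x : Euc n} {t : ℝ} (ht : R⁻¹ < t) (hx : Metric.closedBall x t ⊆ U) :
    essLimsup f x ≤ (mollify ρ f R x : EReal) := by
  -- The gap between `R⁻¹` and `t` leaves room to move the centre: monotonicity holds at every
  -- nearby `y`, and passing to the limit in `r` gives the bound for almost all of them.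
  have hae : ∀ᵐ y, y ∈ Metric.ball x (t - R⁻¹) → f y ≤ mollify ρ f R y := by
    filter_upwards [hρ.ae_tendsto_mollify hf] with y hy hyx
    have hyU : Metric.closedBall y R⁻¹ ⊆ U := by
      refine (Metric.closedBall_subset_closedBall' ?_).trans hx
      have := Metric.mem_ball.1 hyx
      linarith
    refine le_of_tendsto hy ((eventually_ge_atTop R).mono fun r hr => ?_)
    exact hρ.mollify_antitone hn hf hpsh hA hη hη0 hηs heq hR hyU self_mem_Ici hr hr
  refine le_of_forall_gt_imp_ge_of_dense fun c hc => ?_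
  refine limsup_le_of_le (h := ?_)
  have hcont : ContinuousAt (fun y => (mollify ρ f R y : EReal)) x :=
    continuous_coe_real_ereal.continuousAt.comp
      (hρ.mollify_contDiff hf hR).continuous.continuousAt
  have h1 : ∀ᶠ y in 𝓝 x ⊓ ae volume, (mollify ρ f R y : EReal) < c :=
    (hcont.eventually_lt_const hc).filter_mono inf_le_left
  have h2 : ∀ᶠ y in 𝓝 x ⊓ ae volume, y ∈ Metric.ball x (t - R⁻¹) :=
    Filter.Eventually.filter_mono inf_le_left (Metric.ball_mem_nhds x (sub_pos.2 ht))
  have h3 : ∀ᶠ y in 𝓝 x ⊓ ae volume, y ∈ Metric.ball x (t - R⁻¹) → f y ≤ mollify ρ f R y :=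
    hae.filter_mono inf_le_right
  filter_upwards [h1, h2, h3] with y e1 e2 e3
  exact (EReal.coe_le_coe_iff.2 (e3 e2)).trans e1.le

end IsMollifier

end Mollification

/-! ### Smooth majorants of plurisubharmonic functions and the comparison principle -/

section Comparison

variable {n p : ℕ} {G : Set (Submodule ℝ (Euc n))}

theorem isSelfAdjoint_of_mem_lowerCone {B : Euc n →L[ℝ] Euc n} (hB : B ∈ lowerCone G) :
    IsSelfAdjoint B := by
  have hcl : IsClosed {B : Euc n →L[ℝ] Euc n | IsSelfAdjoint B} :=
    isClosed_eq (f := ContinuousLinearMap.adjoint (𝕜 := ℝ) (E := Euc n) (F := Euc n))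
      (LinearIsometryEquiv.continuous _) continuous_id
  refine closure_minimal (fun B hB => ?_) hcl hB
  refine Submodule.span_induction (p := fun B _ => IsSelfAdjoint B) ?_ (IsSelfAdjoint.zero _)
    (fun _ _ _ _ h1 h2 => h1.add h2) (fun c B _ h => ?_) hB
  · rintro _ ⟨ξ, -, rfl⟩
    exact isSelfAdjoint_starProjection ξ
  · exact (IsSelfAdjoint.all (c : ℝ)).smul h

theorem trInner_comm (A B : Euc n →L[ℝ] Euc n) : trInner A B = trInner B A :=
  LinearMap.trace_mul_comm ℝ (A : Euc n →ₗ[ℝ] Euc n) (B : Euc n →ₗ[ℝ] Euc n)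

/-- This easy half of the bipolar theorem suffices: it allows testing the distribution against `A`
and against every projection onto a plane of `G`. -/
theorem lowerCone_subset_polarCone : lowerCone G ⊆ polarCone (upperCone G) := fun B hB =>
  ⟨isSelfAdjoint_of_mem_lowerCone hB, fun A hA => trInner_comm A B ▸ hA.2 B hB⟩

theorem starProjection_mem_lowerCone {ξ : Submodule ℝ (Euc n)} (hξ : ξ ∈ G) :
    ξ.starProjection ∈ lowerCone G :=
  subset_closure (Submodule.subset_span ⟨ξ, hξ, rfl⟩)

/-- A nonempty convex set in finite dimension has nonempty relative interior. -/
theorem IsEllipticSet.exists_posDef (hG : IsEllipticSet p G) :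
    ∃ A ∈ lowerCone G, ∀ x : Euc n, x ≠ 0 → 0 < ⟪A x, x⟫_ℝ := by
  have hc : Convex ℝ (lowerCone G) := (PointedCone.convex _).closure
  have hne : (lowerCone G).Nonempty := ⟨0, subset_closure (zero_mem _)⟩
  obtain ⟨A, hA⟩ := hne.intrinsicInterior hc
  exact ⟨A, intrinsicInterior_subset hA, hG.posDef A hA⟩

/-- A `𝒫⁺(G)`-plurisubharmonic function is dominated on compact sets by smooth plurisubharmonic
functions which are locally controlled by its upper bounds. -/
theorem IsUSCPsh.exists_smooth_majorants (hn : 0 < n) (hG : IsEllipticSet p G)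
    {X : TopologicalSpace.Opens (Euc n)} {u : Euc n → EReal} (hu : IsUSCPsh (upperCone G) X u)
    {Q : Set (Euc n)} (hQ : IsCompact Q) (hQX : Q ⊆ X) :
    ∃ v : ℝ → Euc n → ℝ, ∀ᶠ r in atTop, ContDiff ℝ ∞ (v r) ∧ ∀ x ∈ Q, u x ≤ v r x ∧
      (∀ ξ ∈ G, 0 ≤ constLaplacian ξ.starProjection (v r) x) ∧
      ∀ c : ℝ, (∀ z ∈ Metric.closedBall x r⁻¹, u z ≤ c) → v r x ≤ c := by
  obtain ⟨T, hT, f, hf, hTf, huf⟩ := hu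
  obtain ⟨A, hA, hApos⟩ := hG.exists_posDef
  obtain ⟨η, ρ, hη, hρ, hη0, hρ0, hηs, hρs, hρ1, heq⟩ :=
    exists_mollifier hn (isSelfAdjoint_of_mem_lowerCone hA) hApos
  have hm : IsMollifier ρ := ⟨hρ, hρ0, hρs, hρ1⟩
  obtain ⟨U, hU, hQU, hUX, hUc⟩ := exists_open_between_and_isCompact_closure hQ X.isOpen hQX
  have hUX' : U ⊆ X := subset_closure.trans hUX
  -- Cutting off to a relatively compact `U` makes `f` globally integrable; inside `U`, neither the
  -- distributional inequalities nor the essential limsup change.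
  set g : Euc n → ℝ := U.indicator f with hg
  have hgint : Integrable g := by
    rw [hg, integrable_indicator_iff hU.measurableSet]
    exact (hf.locallyIntegrableOn.integrableOn_compact_subset hUX hUc).mono_set subset_closure
  have hpsh : IsWeaklyPsh (lowerCone G) U g := by
    intro B hB φ hφ hc hs h0
    have h := hT.integral_nonneg hTf (lowerCone_subset_polarCone hB) hφ hc (hs.trans hUX') h0
    refine h.trans_eq (integral_congr_ae (Eventually.of_forall fun x => ?_))
    by_cases hx : x ∈ U
    · simp [hg, hx]
    · have : constLaplacian B φ x = 0 := by
        by_contra h'; exact hx (hs (support_constLaplacian_subset B φ h'))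
      simp [this]
  have hess : ∀ x ∈ U, u x = essLimsup g x := by
    intro x hx
    rw [huf x (hUX' hx)]
    refine limsup_congr (Filter.Eventually.filter_mono inf_le_left ?_)
    filter_upwards [hU.mem_nhds hx] with y hy
    simp [hg, hy]
  have hae : ∀ᵐ z, z ∈ U → u z = (g z : EReal) := by
    filter_upwards [(ae_restrict_iff' X.isOpen.measurableSet).1 hf.ae_eq] with z hz hzU
    rw [huf z (hUX' hzU), hz (hUX' hzU)]
    simp [hg, hzU]
  -- A uniform `t` makes one threshold on `r` valid for all points of `Q`.
  obtain ⟨t, ht, htU⟩ := hQ.exists_cthickening_subset_open hU hQU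
  refine ⟨mollify ρ g, ?_⟩
  have hev : ∀ᶠ r : ℝ in atTop, r⁻¹ < t := tendsto_inv_atTop_zero.eventually_lt_const ht
  filter_upwards [hev, eventually_gt_atTop 0] with r hrt hr
  refine ⟨hm.mollify_contDiff hgint hr, fun x hx => ?_⟩
  have hxt : Metric.closedBall x t ⊆ U := (Metric.closedBall_subset_cthickening hx t).trans htU
  have hxr : Metric.closedBall x r⁻¹ ⊆ U := (Metric.closedBall_subset_closedBall hrt.le).trans hxt
  refine ⟨?_, fun ξ hξ => ?_, fun c hc => ?_⟩
  · rw [hess x (hQU hx)]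
    exact hm.essLimsup_le_mollify hn hgint hpsh hA hη hη0 hηs heq hr hrt hxt
  · exact hm.constLaplacian_mollify_nonneg hgint hpsh (starProjection_mem_lowerCone hξ) hr hxr
  · refine hm.mollify_le hgint hr ?_
    filter_upwards [hae] with z hz hzx
    have := hc z hzx
    rw [hz (hxr hzx)] at this
    exact EReal.coe_le_coe_iff.1 this

theorem hess_norm_sq (x a b : Euc n) : hess (fun y : Euc n => ‖y‖ ^ 2) x a b = 2 * ⟪a, b⟫_ℝ := by
  have h1 : ∀ y : Euc n, fderiv ℝ (fun y : Euc n => ‖y‖ ^ 2) y b = 2 * innerSL ℝ b y := fun y => by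
    rw [fderiv_norm_sq_apply]
    simp [real_inner_comm y b]
  unfold hess
  simp_rw [h1]
  rw [fderiv_const_mul (innerSL ℝ b).differentiableAt]
  change 2 * fderiv ℝ (innerSL ℝ b) x a = _
  rw [ContinuousLinearMap.fderiv, innerSL_apply_apply, real_inner_comm]

/-- The trace of an orthogonal projection is the dimension of its range, so for `p ≥ 1` a small
multiple of `‖y‖²` turns plurisubharmonicity into strict positivity. -/
theorem constLaplacian_add_norm_sq {v : Euc n → ℝ} (hv : ContDiff ℝ ∞ v) (ε : ℝ)
    (ξ : Submodule ℝ (Euc n)) (x : Euc n) :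
    constLaplacian ξ.starProjection (fun y => v y + ε * ‖y‖ ^ 2) x
      = constLaplacian ξ.starProjection v x + 2 * ε * Module.finrank ℝ ξ := by
  have hN : ContDiff ℝ ∞ (fun y : Euc n => ‖y‖ ^ 2) := contDiff_norm_sq ℝ
  have hN2 : ContDiffAt ℝ 2 (fun y : Euc n => ‖y‖ ^ 2) x := hN.contDiffAt.of_le ENat.LEInfty.out
  have h1 : ∀ a b, hess (fun y => v y + ε * ‖y‖ ^ 2) x a b = hess v x a b + ε * (2 * ⟪a, b⟫_ℝ) := by
    intro a b
    rw [← hess_norm_sq x, ← smul_eq_mul, ← hess_const_smul hN2, ← hess_add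
      (hv.contDiffAt.of_le ENat.LEInfty.out) (hN2.const_smul ε)]
    rfl
  have htr : ∑ i, ξ.starProjection (stdVec i) i = Module.finrank ℝ ξ := by
    have h2 : LinearMap.trace ℝ (Euc n) (ξ.starProjection : Euc n →ₗ[ℝ] Euc n)
        = Module.finrank ℝ ξ :=
      LinearMap.IsProj.trace ⟨fun x => ξ.starProjection_apply_mem x,
        fun x hx => Submodule.starProjection_eq_self_iff.2 hx⟩
    rw [← h2, LinearMap.trace_eq_sum_inner _ (EuclideanSpace.basisFun (Fin n) ℝ)]
    simp [EuclideanSpace.inner_single_left]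
  unfold constLaplacian
  simp_rw [h1, mul_add, Finset.sum_add_distrib]
  congr 1
  rw [← htr, Finset.mul_sum]
  refine Finset.sum_congr rfl fun i _ => ?_
  rw [Finset.sum_eq_single i]
  · simp; ring
  · intro j _ hj
    simp [EuclideanSpace.inner_single_left, hj.symm]
  · simp

theorem IsUSCPsh.upperSemicontinuousOn {P : Set (Euc n →L[ℝ] Euc n)}
    {X : TopologicalSpace.Opens (Euc n)} {u : Euc n → EReal} (hu : IsUSCPsh P X u) :
    UpperSemicontinuousOn u X := by
  obtain ⟨T, hT, f, hf, hTf, huf⟩ := hu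
  intro x hx y hy
  rw [huf x hx] at hy
  filter_upwards [hf.isUSC.usc x hx y hy, self_mem_nhdsWithin] with z hz hzX
  rwa [huf z hzX]

/-- The comparison principle: if smooth functions that are strictly plurisubharmonic with respect
to `G` satisfy the maximum principle against `h`, so do plurisubharmonic functions. -/
theorem IsUSCPsh.le_of_le_frontier (hp : 1 ≤ p) (hn : 0 < n) (hG : IsEllipticSet p G)
    {X : TopologicalSpace.Opens (Euc n)} {u : Euc n → EReal} (hu : IsUSCPsh (upperCone G) X u)
    {M : Type*} [TopologicalSpace M] [T2Space M] {ι : M → Euc n} (hι : Continuous ι)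
    {K : Set M} (hK : IsCompact K) (hKX : ∀ m ∈ K, ι m ∈ X) {h : M → ℝ}
    (hh : ContinuousOn h K)
    (hmax : ∀ v : Euc n → ℝ, ContDiff ℝ ∞ v → ∀ m ∈ K,
      (∀ ξ ∈ G, 0 < constLaplacian ξ.starProjection v (ι m)) →
        ¬ IsLocalMax (fun m => v (ι m) - h m) m)
    (hfr : ∀ m ∈ frontier K, u (ι m) ≤ h m) : ∀ m ∈ K, u (ι m) ≤ h m := by
  have husc := hu.upperSemicontinuousOn
  obtain ⟨v, hv⟩ := hu.exists_smooth_majorants hn hG (hK.image hι)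
    (by rintro _ ⟨m, hm, rfl⟩; exact hKX m hm)
  have hKcl : IsClosed K := hK.isClosed
  have hfrK : frontier K ⊆ K := hKcl.frontier_subset
  have hfrc : IsCompact (frontier K) := hK.of_isClosed_subset isClosed_frontier hfrK
  -- A Hartogs-type argument: near each frontier point, half of `δ` absorbs the semicontinuity of
  -- `u` and half the variation of `h`; compactness makes the threshold on `r` uniform.
  have hbound : ∀ δ : ℝ, 0 < δ → ∀ᶠ r in atTop, ∀ m ∈ frontier K, v r (ι m) < h m + δ := by
    intro δ hδ
    refine hfrc.induction_on (p := fun S => ∀ᶠ r in atTop, ∀ m ∈ S, v r (ι m) < h m + δ)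
      (by simp) (fun s t hst ht => ht.mono fun r hr m hm => hr m (hst hm))
      (fun s t hs ht => (hs.and ht).mono fun r hr m hm => hm.elim (hr.1 m) (hr.2 m)) ?_
    intro m hm
    have hlt : u (ι m) < ((h m + δ / 2 : ℝ) : EReal) :=
      (hfr m hm).trans_lt (EReal.coe_lt_coe_iff.2 (by linarith))
    have hnear : ∀ᶠ z in 𝓝 (ι m), u z < ((h m + δ / 2 : ℝ) : EReal) := by
      have := husc (ι m) (hKX m (hfrK hm)) _ hlt
      rwa [X.isOpen.nhdsWithin_eq (hKX m (hfrK hm))] at this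
    obtain ⟨ε, hε, hball⟩ := Metric.eventually_nhds_iff_ball.1 hnear
    have h1 : ∀ᶠ m' in 𝓝[frontier K] m, h m - δ / 2 < h m' :=
      ((hh m (hfrK hm)).mono hfrK).eventually_const_lt (by linarith)
    have h2 : ∀ᶠ m' in 𝓝[frontier K] m, ι m' ∈ Metric.ball (ι m) (ε / 2) :=
      (hι.continuousAt.eventually (Metric.ball_mem_nhds _ (half_pos hε))).filter_mono
        nhdsWithin_le_nhds
    refine ⟨_, inter_mem (inter_mem h1 h2) self_mem_nhdsWithin, ?_⟩
    have hev : ∀ᶠ r : ℝ in atTop, r⁻¹ < ε / 2 :=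
      tendsto_inv_atTop_zero.eventually_lt_const (half_pos hε)
    filter_upwards [hv, hev] with r hr hrε m' hm'
    refine (((hr.2 (ι m') (mem_image_of_mem ι (hfrK hm'.2))).2.2 (h m + δ / 2)
      fun z hz => (hball z ?_).le)).trans_lt ?_
    · have h3 := Metric.mem_closedBall.1 hz
      have h4 := Metric.mem_ball.1 hm'.1.2
      exact Metric.mem_ball.2 (by linarith [dist_triangle z (ι m') (ι m)])
    · have : h m - δ / 2 < h m' := hm'.1.1
      linarith
  obtain ⟨C, hC⟩ : ∃ C : ℝ, ∀ m ∈ K, ‖ι m‖ ^ 2 ≤ C := by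
    obtain ⟨C, hC⟩ := hK.exists_bound_of_continuousOn (f := fun m => ‖ι m‖ ^ 2)
      (by fun_prop)
    exact ⟨C, fun m hm => (le_abs_self _).trans (hC m hm)⟩
  have hmain : ∀ δ : ℝ, 0 < δ → ∀ m ∈ K, u (ι m) ≤ ((h m + 2 * δ : ℝ) : EReal) := by
    intro δ hδ m hm
    obtain ⟨r, hr, hrb⟩ := (hv.and (hbound δ hδ)).exists
    have hC0 : 0 ≤ C := (sq_nonneg _).trans (hC m hm)
    -- This choice keeps `ε ‖ι m‖² ≤ δ` on `K`; the `+ 1` guards against `C = 0`.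
    set ε := δ / (C + 1) with hεdef
    have hε : 0 < ε := by positivity
    have hεC : ε * C ≤ δ := by
      rw [hεdef, div_mul_eq_mul_div, div_le_iff₀ (by positivity)]; nlinarith
    set w : Euc n → ℝ := fun y => v r y + ε * ‖y‖ ^ 2 with hw
    have hws : ContDiff ℝ ∞ w := hr.1.add (contDiff_const.mul (contDiff_norm_sq ℝ))
    obtain ⟨m₀, hm₀, hm₀max⟩ := hK.exists_isMaxOn ⟨m, hm⟩
      (f := fun m => w (ι m) - h m) ((hws.continuous.comp hι).continuousOn.sub hh)
    have hm₀fr : m₀ ∈ frontier K := by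
      rw [hKcl.frontier_eq]
      refine ⟨hm₀, fun hint => hmax w hws m₀ hm₀ (fun ξ hξ => ?_)
        (hm₀max.isLocalMax (mem_interior_iff_mem_nhds.1 hint))⟩
      rw [hw, constLaplacian_add_norm_sq hr.1, hG.finrank_eq ξ hξ]
      have h1 := (hr.2 (ι m₀) (mem_image_of_mem ι hm₀)).2.1 ξ hξ
      have h2 : (1 : ℝ) ≤ p := by exact_mod_cast hp
      have : 0 < 2 * ε * p := by positivity
      linarith
    have h1 : w (ι m) - h m ≤ w (ι m₀) - h m₀ := hm₀max hm
    have h2 := hrb m₀ hm₀fr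
    have h3 : ε * ‖ι m₀‖ ^ 2 ≤ ε * C := mul_le_mul_of_nonneg_left (hC m₀ hm₀) hε.le
    have h4 : 0 ≤ ε * ‖ι m‖ ^ 2 := by positivity
    refine (hr.2 (ι m) (mem_image_of_mem ι hm)).1.trans (EReal.coe_le_coe_iff.2 ?_)
    simp only [hw] at h1
    linarith
  intro m hm
  refine EReal.le_of_forall_lt_iff_le.1 fun z hz => ?_
  have hz' : h m < z := EReal.coe_lt_coe_iff.1 hz
  have := hmain ((z - h m) / 2) (by linarith) m hm
  rwa [show h m + 2 * ((z - h m) / 2) = z by ring] at this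

end Comparison

/-! ### Traces along planes -/

section PlaneTrace

variable {n : ℕ} {κ : Type*} [Fintype κ] [DecidableEq κ]

/-- The candidate lies in `ξ`, and the inverse Gram matrix is exactly what makes the remainder
orthogonal to every `w k`. -/
theorem starProjection_eq_sum_inv_gram {w : κ → Euc n} (hw : LinearIndependent ℝ w)
    {ξ : Submodule ℝ (Euc n)} (hξ : ξ = Submodule.span ℝ (range w)) (e : Euc n) :
    ξ.starProjection e = ∑ i, ∑ j, ((Matrix.gram ℝ w)⁻¹ i j * ⟪w j, e⟫_ℝ) • w i := by
  subst hξ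
  have hdet : IsUnit (Matrix.gram ℝ w).det :=
    isUnit_iff_ne_zero.2 (Matrix.det_gram_ne_zero_iff_linearIndependent.2 hw)
  refine Submodule.eq_starProjection_of_mem_of_inner_eq_zero ?_ fun z hz => ?_
  · exact Submodule.sum_mem _ fun i _ => Submodule.sum_mem _ fun j _ =>
      Submodule.smul_mem _ _ (Submodule.subset_span (mem_range_self i))
  · refine Submodule.span_induction (p := fun z _ => ⟪e - _, z⟫_ℝ = 0) ?_ (inner_zero_right _)
      (fun x y _ _ hx hy => by rw [inner_add_right, hx, hy, add_zero])
      (fun c x _ hx => by rw [inner_smul_right, hx, mul_zero]) hz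
    rintro _ ⟨k, rfl⟩
    rw [inner_sub_left, sum_inner]
    simp_rw [sum_inner, real_inner_smul_left]
    have h1 : ∀ j, ∑ i, (Matrix.gram ℝ w)⁻¹ i j * ⟪w j, e⟫_ℝ * ⟪w i, w k⟫_ℝ
        = ⟪w j, e⟫_ℝ * (1 : Matrix κ κ ℝ) k j := by
      intro j
      rw [← Matrix.mul_nonsing_inv _ hdet, Matrix.mul_apply, Finset.mul_sum]
      refine Finset.sum_congr rfl fun i _ => ?_
      rw [Matrix.gram_apply, real_inner_comm (w i) (w k)]; ring
    rw [Finset.sum_comm]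
    simp_rw [h1]
    simp [Matrix.one_apply, real_inner_comm]

/-- Both sides are the trace of the Hessian along `ξ`, in an arbitrary basis of the plane and
through its projection. This links intrinsic Laplacians to the cone condition. -/
theorem sum_inv_gram_mul_hess {w : κ → Euc n} (hw : LinearIndependent ℝ w)
    {ξ : Submodule ℝ (Euc n)} (hξ : ξ = Submodule.span ℝ (range w)) {v : Euc n → ℝ} {x : Euc n}
    (hv : ContDiffAt ℝ 2 v x) :
    ∑ i, ∑ j, (Matrix.gram ℝ w)⁻¹ i j * hess v x (w i) (w j)
      = constLaplacian ξ.starProjection v x := by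
  unfold constLaplacian
  simp_rw [hess_eq hv]
  set H := fderiv ℝ (fderiv ℝ v) x
  have h1 : ∀ z e : Euc n, ∑ i, z i * H (stdVec i) e = H z e := fun z e => by
    rw [apply_eq_sum_stdVec H z]; simp
  have h2 : ∀ z e : Euc n, ∑ j, e j * H z (stdVec j) = H z e := fun z e => by
    rw [apply_eq_sum_stdVec (H z) e]; simp
  have h3 : ∑ i, ∑ j, ξ.starProjection (stdVec j) i * H (stdVec i) (stdVec j)
      = ∑ j, H (ξ.starProjection (stdVec j)) (stdVec j) := by
    rw [Finset.sum_comm]; simp_rw [h1]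
  rw [h3]
  simp_rw [starProjection_eq_sum_inv_gram hw hξ]
  simp only [map_sum, map_smul, sum_apply, smul_apply, smul_eq_mul]
  rw [Finset.sum_comm (f := fun b i => ∑ j, (Matrix.gram ℝ w)⁻¹ i j * ⟪w j, stdVec b⟫_ℝ *
    H (w i) (stdVec b))]
  refine Finset.sum_congr rfl fun i _ => ?_
  rw [Finset.sum_comm (f := fun b j => (Matrix.gram ℝ w)⁻¹ i j * ⟪w j, stdVec b⟫_ℝ *
    H (w i) (stdVec b))]
  refine Finset.sum_congr rfl fun j _ => ?_
  rw [← h2, Finset.mul_sum]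
  refine Finset.sum_congr rfl fun b _ => ?_
  rw [EuclideanSpace.inner_single_right]
  simp; ring

open scoped MatrixOrder in
theorem Matrix.PosSemidef.exists_eq_sum {A : Matrix κ κ ℝ} (hA : A.PosSemidef) :
    ∃ B : Matrix κ κ ℝ, ∀ i j, A i j = ∑ k, B k i * B k j := by
  obtain ⟨B, rfl⟩ := CStarAlgebra.nonneg_iff_eq_star_mul_self.mp hA.nonneg
  exact ⟨B, fun i j => by simp [Matrix.mul_apply, Matrix.star_eq_conjTranspose]⟩

/-- At a local maximum, the contraction of the Hessian with a positive semidefinite matrix is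
nonpositive. -/
theorem IsLocalMax.sum_mul_hess_nonpos {E : Type*} [NormedAddCommGroup E] [NormedSpace ℝ E]
    {f : E → ℝ} {y : E} (hmax : IsLocalMax f y) (hf : ContDiffAt ℝ 2 f y) (e : κ → E)
    {A : Matrix κ κ ℝ} (hA : A.PosSemidef) :
    ∑ i, ∑ j, A i j * hess f y (e i) (e j) ≤ 0 := by
  obtain ⟨B, hB⟩ := hA.exists_eq_sum
  -- The factorization `A = Bᵀ B` rewrites the contraction as a sum of pure second derivatives, one
  -- along each row of `B`.
  have h1 : ∑ i, ∑ j, A i j * hess f y (e i) (e j)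
      = ∑ k, hess f y (∑ i, B k i • e i) (∑ j, B k j • e j) := by
    simp_rw [hess_eq hf, hB, map_sum, map_smul, sum_apply, smul_apply, smul_eq_mul,
      Finset.sum_mul, Finset.mul_sum]
    rw [Finset.sum_congr rfl fun i _ => Finset.sum_comm, Finset.sum_comm]
    exact Finset.sum_congr rfl fun k _ => Finset.sum_comm.trans <|
      Finset.sum_congr rfl fun i _ => Finset.sum_congr rfl fun j _ => by ring
  rw [h1]
  exact Finset.sum_nonpos fun k _ => hmax.hess_nonpos hf _

/-- The chain rule for second derivatives. -/
theorem hess_comp {E F : Type*} [NormedAddCommGroup E] [NormedSpace ℝ E] [NormedAddCommGroup F]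
    [NormedSpace ℝ F] {v : F → ℝ} {ψ : E → F} {y : E} (hv : ContDiffAt ℝ 2 v (ψ y))
    (hψ : ContDiffAt ℝ 2 ψ y) (a b : E) :
    hess (fun z => v (ψ z)) y a b
      = hess v (ψ y) (fderiv ℝ ψ y a) (fderiv ℝ ψ y b) + fderiv ℝ v (ψ y) (hess ψ y a b) := by
  have hev : (fun z => fderiv ℝ (fun z => v (ψ z)) z b)
      =ᶠ[𝓝 y] fun z => fderiv ℝ v (ψ z) (fderiv ℝ ψ z b) := by
    filter_upwards [hψ.continuousAt.eventually (eventually_differentiableAt hv),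
      eventually_differentiableAt hψ] with z h1 h2
    have : fderiv ℝ (fun z => v (ψ z)) z = _ := fderiv_comp z h1 h2
    rw [this]; rfl
  have hψd : DifferentiableAt ℝ ψ y := hψ.differentiableAt (by norm_num)
  have h1 : HasFDerivAt (fun z => fderiv ℝ v (ψ z)) _ y :=
    hv.differentiableAt_fderiv.hasFDerivAt.comp y hψd.hasFDerivAt
  have h2 : DifferentiableAt ℝ (fun z => fderiv ℝ ψ z b) y :=
    hψ.differentiableAt_fderiv.clm_apply (differentiableAt_const b)
  rw [hess_eq hv]
  conv_lhs => rw [hess, hev.fderiv_eq]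
  rw [(h1.clm_apply h2.hasFDerivAt).fderiv]
  simp [hess, add_comm]

end PlaneTrace

/-! ### Restrictions to affine planes and to minimal submanifolds -/

section Restriction

variable {n p : ℕ} {G : Set (Submodule ℝ (Euc n))}

/-- The restriction of a plurisubharmonic function to a connected set is in `USC`, unless it is
identically `-∞`. -/
theorem IsUSCPsh.isUSC_comp {P : Set (Euc n →L[ℝ] Euc n)}
    {X : TopologicalSpace.Opens (Euc n)} {u : Euc n → EReal} (hu : IsUSCPsh P X u)
    {M : Type*} [TopologicalSpace M] {S : Set M} (hS : IsPreconnected S) {ι : M → Euc n}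
    (hι : Continuous ι) (hSX : ∀ m ∈ S, ι m ∈ X) (hne : ∃ m ∈ S, u (ι m) ≠ ⊥) :
    IsUSC S fun m => u (ι m) where
  usc := fun m hm y hy => by
    have h := hu.upperSemicontinuousOn (ι m) (hSX m hm) y hy
    exact (tendsto_nhdsWithin_iff.2 ⟨hι.continuousWithinAt,
      eventually_nhdsWithin_of_forall hSX⟩ : Tendsto ι (𝓝[S] m) (𝓝[X] (ι m))).eventually h
  ne_top := fun m hm => by
    obtain ⟨T, hT, f, hf, hTf, huf⟩ := hu
    rw [huf _ (hSX m hm)]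
    exact hf.isUSC.ne_top _ (hSX m hm)
  ne_bot := fun m hm => by
    obtain ⟨m', hm', h⟩ := hne
    exact ⟨m', hS.subset_connectedComponentIn hm subset_rfl hm', h⟩

/-- At a local maximum of `v - h` on the plane, the trace of the Hessian in an orthonormal basis is
nonpositive. As `h` is harmonic it equals the trace of `D²v` along `ξ`, which is positive. -/
theorem IsUSCPsh.isSubharmonicOn_affine (hp : 1 ≤ p) (hG : IsEllipticSet p G)
    {X : TopologicalSpace.Opens (Euc n)} {u : Euc n → EReal} (hu : IsUSCPsh (upperCone G) X u)
    {ξ : Submodule ℝ (Euc n)} (hξ : ξ ∈ G) (a : Euc n)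
    (hS : IsPreconnected {y : ξ | a + (y : Euc n) ∈ X})
    (hne : ∃ y : ξ, a + (y : Euc n) ∈ X ∧ u (a + (y : Euc n)) ≠ ⊥) :
    IsSubharmonicOn {y : ξ | a + (y : Euc n) ∈ X} (fun y : ξ => u (a + (y : Euc n))) where
  isUSC := hu.isUSC_comp hS (ι := fun y : ξ => a + (y : Euc n)) (by fun_prop)
    (fun _ hy => hy) hne
  le_of_frontier := fun K hK hKX h hh hfr => by
    have hn : 0 < n := by
      have h1 := hG.finrank_eq ξ hξ
      have h2 := Submodule.finrank_le ξ
      rw [finrank_euclideanSpace_fin] at h2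
      omega
    refine hu.le_of_le_frontier hp hn hG (ι := fun y : ξ => a + (y : Euc n)) (by fun_prop) hK
      hKX (fun y hy => (hh y hy).1.continuousAt.continuousWithinAt) ?_ hfr
    intro v hv y hy hpos hmax
    have hv2 : ContDiffAt ℝ 2 v (a + (y : Euc n)) := hv.contDiffAt.of_le ENat.LEInfty.out
    have hι : ContDiff ℝ 2 (fun y : ξ => a + (y : Euc n)) := contDiff_const.add ξ.subtypeL.contDiff
    have hιd : ∀ y : ξ, fderiv ℝ (fun y : ξ => a + (y : Euc n)) y = ξ.subtypeL := fun y =>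
      (ξ.subtypeL.hasFDerivAt.const_add a).fderiv
    let b := stdOrthonormalBasis ℝ ξ
    let w : Fin (Module.finrank ℝ ξ) → Euc n := fun i => (b i : Euc n)
    have hwo : Orthonormal ℝ w := b.orthonormal.comp_linearIsometry ξ.subtypeₗᵢ
    have hgram : Matrix.gram ℝ w = 1 := by
      ext i j
      rw [Matrix.gram_apply, orthonormal_iff_ite.1 hwo, Matrix.one_apply]
    have hspan : ξ = Submodule.span ℝ (range w) := by
      have h1 : range w = ξ.subtype '' range b := by rw [← range_comp]; rfl
      rw [h1, ← Submodule.map_span, ← b.coe_toBasis, b.toBasis.span_eq, Submodule.map_top,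
        Submodule.range_subtype]
    have hsum := sum_inv_gram_mul_hess hwo.linearIndependent hspan hv2
    have hcomp : ContDiffAt ℝ 2 (fun z : ξ => v (a + (z : Euc n))) y :=
      hv2.comp y hι.contDiffAt
    have hh2 : ContDiffAt ℝ 2 h y := (hh y hy).1
    have hdiff : ∀ i j, hess (fun z : ξ => v (a + (z : Euc n)) - h z) y (b i) (b j)
        = hess v (a + (y : Euc n)) (w i) (w j) - hess h y (b i) (b j) := by
      intro i j
      have e1 : (fun z : ξ => v (a + (z : Euc n)) - h z)
          = fun z : ξ => v (a + (z : Euc n)) + (-1 : ℝ) • h z := by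
        ext z; simp [sub_eq_add_neg]
      rw [e1, hess_add hcomp (hh2.const_smul (-1 : ℝ)), hess_const_smul hh2,
        hess_comp (ψ := fun z : ξ => a + (z : Euc n)) hv2 hι.contDiffAt]
      -- The parametrization is affine, so the chain rule has no first-order term.
      have e2 : hess (fun y : ξ => a + (y : Euc n)) y (b i) (b j) = 0 := by
        unfold hess; simp [hιd]
      rw [e2, map_zero, hιd]
      simp [w, sub_eq_add_neg]
    have hle := hmax.sum_mul_hess_nonpos (hcomp.sub hh2) b
      (Matrix.PosSemidef.one (n := Fin (Module.finrank ℝ ξ)) (R := ℝ))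
    have hlap : ∑ i, hess h y (b i) (b i) = 0 := by
      have h1 := (hh y hy).2.self_of_nhds
      rw [InnerProductSpace.laplacian_eq_iteratedFDeriv_orthonormalBasis h b] at h1
      simpa [iteratedFDeriv_two_apply, hess_eq hh2] using h1
    simp_rw [hdiff] at hle
    rw [hgram, inv_one] at hsum
    simp only [Matrix.one_apply, ite_mul, one_mul, zero_mul, Finset.sum_ite_eq, Finset.mem_univ,
      if_true] at hle hsum
    rw [Finset.sum_sub_distrib, hlap, hsum, sub_zero] at hle
    exact absurd hle (not_le.2 (hpos ξ hξ))

end Restriction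

/-! ### The Laplace–Beltrami operator in coordinates and Gauss' formula. -/

section LaplaceBeltrami

variable {n p : ℕ}

theorem laplaceBeltramiCoord_sub (g : Euc p → Matrix (Fin p) (Fin p) ℝ) {f₁ f₂ : Euc p → ℝ}
    {y : Euc p} (h₁ : ContDiffAt ℝ 2 f₁ y) (h₂ : ContDiffAt ℝ 2 f₂ y) :
    laplaceBeltramiCoord g (fun z => f₁ z - f₂ z) y
      = laplaceBeltramiCoord g f₁ y - laplaceBeltramiCoord g f₂ y := by
  have e1 : (fun z => f₁ z - f₂ z) = fun z => f₁ z + (-1 : ℝ) • f₂ z := by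
    ext z; simp [sub_eq_add_neg]
  have hh : ∀ i j, pderivE i (pderivE j fun z => f₁ z - f₂ z) y
      = pderivE i (pderivE j f₁) y - pderivE i (pderivE j f₂) y := fun i j => by
    change hess _ y _ _ = hess _ y _ _ - hess _ y _ _
    rw [e1, hess_add h₁ (h₂.const_smul (-1 : ℝ)), hess_const_smul h₂]
    simp [sub_eq_add_neg]
  have hd : ∀ k, pderivE k (fun z => f₁ z - f₂ z) y = pderivE k f₁ y - pderivE k f₂ y := fun k => by
    unfold pderivE
    rw [fderiv_fun_sub (h₁.differentiableAt (by norm_num)) (h₂.differentiableAt (by norm_num))]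
    rfl
  unfold laplaceBeltramiCoord
  simp_rw [hh, hd, mul_sub, Finset.sum_sub_distrib, mul_sub, Finset.sum_sub_distrib]
  ring

/-- At a local maximum the Laplace-Beltrami operator is nonpositive. -/
theorem IsLocalMax.laplaceBeltramiCoord_nonpos {g : Euc p → Matrix (Fin p) (Fin p) ℝ}
    {f : Euc p → ℝ} {y : Euc p} (hmax : IsLocalMax f y) (hf : ContDiffAt ℝ 2 f y)
    (hg : (g y).PosSemidef) : laplaceBeltramiCoord g f y ≤ 0 := by
  -- The gradient vanishes at the maximum, so the Christoffel terms drop out.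
  have hd : ∀ k, pderivE k f y = 0 := fun k => by simp [pderivE, hmax.fderiv_eq_zero]
  have := hmax.sum_mul_hess_nonpos hf (fun i => stdVec i) hg.inv
  simp only [laplaceBeltramiCoord, hd, mul_zero, Finset.sum_const_zero, sub_zero]
  exact this

/-- Gauss' formula: the Christoffel symbols of the metric induced by a parametrization `ψ`
are the coefficients of the tangential part of its second derivatives. -/
theorem sum_christoffel_smul {ψ : Euc p → Euc n} {y : Euc p} (hψ : ContDiffAt ℝ 2 ψ y)
    (hw : LinearIndependent ℝ fun i => pderivE i ψ y) (i j : Fin p) :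
    ∑ k, christoffel (fun z => Matrix.of fun i j => ⟪pderivE i ψ z, pderivE j ψ z⟫_ℝ) k i j y •
        pderivE k ψ y
      = (Submodule.span ℝ (range fun i => pderivE i ψ y)).starProjection
          (pderivE i (pderivE j ψ) y) := by
  have hdiff : ∀ j, DifferentiableAt ℝ (pderivE j ψ) y := fun j =>
    hψ.differentiableAt_fderiv.clm_apply (differentiableAt_const _)
  have hmet : ∀ i j l, pderivE i (fun z => ⟪pderivE j ψ z, pderivE l ψ z⟫_ℝ) y
      = ⟪pderivE j ψ y, pderivE i (pderivE l ψ) y⟫_ℝ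
        + ⟪pderivE i (pderivE j ψ) y, pderivE l ψ y⟫_ℝ := fun i j l =>
    fderiv_inner_apply ℝ (hdiff j) (hdiff l) _
  have hsymm : ∀ i j, pderivE i (pderivE j ψ) y = pderivE j (pderivE i ψ) y := fun i j =>
    hess_symm hψ _ _
  rw [starProjection_eq_sum_inv_gram hw rfl]
  refine Finset.sum_congr rfl fun k _ => ?_
  rw [← Finset.sum_smul]
  congr 1
  unfold christoffel
  rw [Finset.mul_sum]
  refine Finset.sum_congr rfl fun l _ => ?_
  have hgram : (Matrix.of fun i j => ⟪pderivE i ψ y, pderivE j ψ y⟫_ℝ)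
      = Matrix.gram ℝ fun i => pderivE i ψ y := rfl
  simp only [Matrix.of_apply, hmet, hgram]
  -- By symmetry of second derivatives, the three metric derivatives combine to `2 ⟪∂ₗψ, ∂ᵢ∂ⱼψ⟫` and
  -- the other terms cancel.
  rw [hsymm l i, hsymm l j, hsymm j i,
    real_inner_comm (pderivE i (pderivE j ψ) y) (pderivE l ψ y),
    real_inner_comm (pderivE j ψ y) (pderivE i (pderivE l ψ) y)]
  ring

/-- The Laplace-Beltrami operator of the restriction of `v` to a parametrized submanifold, in
terms of the tangential trace of `D²v` and of the mean curvature vector. -/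
theorem laplaceBeltramiCoord_comp {ψ : Euc p → Euc n} {y : Euc p} (hψ : ContDiffAt ℝ 2 ψ y)
    (hw : LinearIndependent ℝ fun i => pderivE i ψ y) {ξ : Submodule ℝ (Euc n)}
    (hξ : ξ = Submodule.span ℝ (range fun i => pderivE i ψ y)) {v : Euc n → ℝ}
    (hv : ContDiffAt ℝ 2 v (ψ y)) :
    laplaceBeltramiCoord (fun z => Matrix.of fun i j => ⟪pderivE i ψ z, pderivE j ψ z⟫_ℝ)
        (fun z => v (ψ z)) y
      = constLaplacian ξ.starProjection v (ψ y)
        + fderiv ℝ v (ψ y) (∑ i, ∑ j,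
            (Matrix.of fun i j => ⟪pderivE i ψ y, pderivE j ψ y⟫_ℝ)⁻¹ i j •
              ξᗮ.starProjection (pderivE i (pderivE j ψ) y)) := by
  have hgram : (Matrix.of fun i j => ⟪pderivE i ψ y, pderivE j ψ y⟫_ℝ)
      = Matrix.gram ℝ fun i => pderivE i ψ y := rfl
  have h1 : ∀ i j, pderivE i (pderivE j fun z => v (ψ z)) y
      = hess v (ψ y) (pderivE i ψ y) (pderivE j ψ y)
        + fderiv ℝ v (ψ y) (pderivE i (pderivE j ψ) y) := fun i j => hess_comp hv hψ _ _
  have h2 : ∀ k, pderivE k (fun z => v (ψ z)) y = fderiv ℝ v (ψ y) (pderivE k ψ y) := fun k => by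
    have : fderiv ℝ (fun z => v (ψ z)) y = _ :=
      fderiv_comp y (hv.differentiableAt (by norm_num)) (hψ.differentiableAt (by norm_num))
    rw [pderivE, this]; rfl
  -- By Gauss' formula the Christoffel correction subtracts the tangential part of `∂ᵢ∂ⱼψ`, leaving
  -- only its normal part.
  have h3 : ∀ i j, ∑ k, christoffel
      (fun z => Matrix.of fun i j => ⟪pderivE i ψ z, pderivE j ψ z⟫_ℝ) k i j y *
        fderiv ℝ v (ψ y) (pderivE k ψ y)
      = fderiv ℝ v (ψ y) (ξ.starProjection (pderivE i (pderivE j ψ) y)) := fun i j => by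
    rw [hξ, ← sum_christoffel_smul hψ hw i j, map_sum]
    simp
  rw [← sum_inv_gram_mul_hess hw hξ hv, hgram]
  unfold laplaceBeltramiCoord
  simp_rw [h1, h2, h3, hgram, map_sum, map_smul, ← Finset.sum_add_distrib,
    Submodule.starProjection_orthogonal_val, map_sub, smul_eq_mul]
  exact Finset.sum_congr rfl fun i _ => Finset.sum_congr rfl fun j _ => by ring

end LaplaceBeltrami

/-! ### From charts to minimal immersed submanifolds. -/

section MinimalSubmanifold

variable {n p : ℕ} {M : Type*} [TopologicalSpace M] [ChartedSpace (Euc p) M]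

theorem ContMDiffAt.contDiffAt_comp_chart_symm {F : Type*} [NormedAddCommGroup F] [NormedSpace ℝ F]
    {k : WithTop ℕ∞} {f : M → F} {m : M} (hf : ContMDiffAt (𝓡 p) 𝓘(ℝ, F) k f m) :
    ContDiffAt ℝ k (f ∘ (chartAt (Euc p) m).symm) (chartAt (Euc p) m m) := by
  have := (contMDiffAt_iff.1 hf).2
  simp only [mfld_simps, contDiffWithinAt_univ] at this
  exact this

theorem differential_eq_fderiv_localParam {ι : M → Euc n} {m : M}
    (hι : MDifferentiableAt (𝓡 p) 𝓘(ℝ, Euc n) ι m) :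
    differential p ι m = fderiv ℝ (localParam p ι m) (chartAt (Euc p) m m) := by
  unfold differential
  rw [hι.mfderiv]
  simp only [writtenInExtChartAt, localParam, mfld_simps, fderivWithin_univ]
  rfl

theorem tangentPlane_eq_span {ι : M → Euc n} {m : M}
    (hι : MDifferentiableAt (𝓡 p) 𝓘(ℝ, Euc n) ι m) :
    tangentPlane p ι m = Submodule.span ℝ
      (range fun i => pderivE i (localParam p ι m) (chartAt (Euc p) m m)) := by
  unfold tangentPlane
  rw [differential_eq_fderiv_localParam hι, LinearMap.range_eq_map,
    ← (EuclideanSpace.basisFun (Fin p) ℝ).toBasis.span_eq, Submodule.map_span, ← range_comp]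
  congr 2
  ext i
  simp [pderivE]

theorem IsImmersedSubmanifold.linearIndependent {ι : M → Euc n} (hι : IsImmersedSubmanifold p ι)
    (m : M) : LinearIndependent ℝ
      fun i => pderivE i (localParam p ι m) (chartAt (Euc p) m m) := by
  have hd := hι.contMDiff.mdifferentiable (by simp) m
  have h1 := hι.injective_differential m
  rw [differential_eq_fderiv_localParam hd] at h1
  have h2 := (EuclideanSpace.basisFun (Fin p) ℝ).toBasis.linearIndependent.map'
    (fderiv ℝ (localParam p ι m) (chartAt (Euc p) m m) : Euc p →ₗ[ℝ] Euc n)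
    (LinearMap.ker_eq_bot.2 h1)
  have h3 : (fun i => pderivE i (localParam p ι m) (chartAt (Euc p) m m))
      = (fderiv ℝ (localParam p ι m) (chartAt (Euc p) m m) : Euc p →ₗ[ℝ] Euc n) ∘
        (EuclideanSpace.basisFun (Fin p) ℝ).toBasis := by
    ext i
    simp [pderivE]
  rwa [h3]

/-- In the preferred chart at a local maximum of `v ∘ ι - h`, the Laplace–Beltrami operator is
nonpositive. But harmonicity of `h` and minimality make it the trace of `D²v` along a plane of `G`,
which is positive. -/
theorem IsUSCPsh.isSubharmonicInduced {G : Set (Submodule ℝ (Euc n))} (hp : 1 ≤ p)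
    (hG : IsEllipticSet p G) {X : TopologicalSpace.Opens (Euc n)} {u : Euc n → EReal}
    (hu : IsUSCPsh (upperCone G) X u) [T2Space M] [ConnectedSpace M] {ι : M → Euc n}
    (hι : IsImmersedSubmanifold p ι) (hιX : ∀ m, ι m ∈ X) (hιG : ∀ m, tangentPlane p ι m ∈ G)
    (hmin : IsMinimalSubmanifold p ι) (hne : ∃ m, u (ι m) ≠ ⊥) :
    IsSubharmonicInduced p ι fun m => u (ι m) where
  isUSC := hu.isUSC_comp isPreconnected_univ hι.contMDiff.continuous (fun m _ => hιX m)
    (hne.imp fun m h => ⟨mem_univ m, h⟩)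
  le_of_frontier := fun K hK h hh hfr => by
    have hn : 0 < n := by
      obtain ⟨m, -⟩ := hne
      have h1 := hG.finrank_eq _ (hιG m)
      have h2 := Submodule.finrank_le (tangentPlane p ι m)
      rw [finrank_euclideanSpace_fin] at h2
      omega
    refine hu.le_of_le_frontier hp hn hG hι.contMDiff.continuous hK (fun m _ => hιX m)
      (fun m hm => (hh m hm).1.continuousAt.continuousWithinAt) ?_ hfr
    intro v hv m hm hpos hmax
    set y := chartAt (Euc p) m m with hy
    have hsymm : (chartAt (Euc p) m).symm y = m :=
      (chartAt (Euc p) m).left_inv (mem_chart_source _ m)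
    have hψy : localParam p ι m y = ι m := congrArg ι hsymm
    have hψ : ContDiffAt ℝ 2 (localParam p ι m) y :=
      ((hι.contMDiff m).contDiffAt_comp_chart_symm).of_le ENat.LEInfty.out
    have hh2 : ContDiffAt ℝ 2 (h ∘ (chartAt (Euc p) m).symm) y :=
      (hh m hm).1.contDiffAt_comp_chart_symm
    have hv2 : ContDiffAt ℝ 2 v (localParam p ι m y) := hv.contDiffAt.of_le ENat.LEInfty.out
    have hw := hι.linearIndependent m
    have htan := tangentPlane_eq_span (hι.contMDiff.mdifferentiable (by simp) m)
    have hcont : ContinuousAt (chartAt (Euc p) m).symm y :=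
      (chartAt (Euc p) m).continuousAt_symm (mem_chart_target _ m)
    have hmax' : IsLocalMax (fun z => v (localParam p ι m z) - (h ∘ (chartAt (Euc p) m).symm) z) y := by
      have h1 : Tendsto (chartAt (Euc p) m).symm (𝓝 y) (𝓝 m) := by
        simpa [ContinuousAt, hsymm] using hcont
      have := h1.eventually hmax
      simpa [IsLocalMax, IsMaxFilter, localParam, hsymm] using this
    have hcomp : ContDiffAt ℝ 2 (fun z => v (localParam p ι m z)) y := hv2.comp y hψ
    have hle := hmax'.laplaceBeltramiCoord_nonpos (g := inducedMetric p ι m) (hcomp.sub hh2)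
      (Matrix.posSemidef_gram ℝ fun i => pderivE i (localParam p ι m) y)
    have hlap : laplaceBeltramiCoord (inducedMetric p ι m) (h ∘ (chartAt (Euc p) m).symm) y = 0 :=
      (hh m hm).2.self_of_nhds
    have hH := laplaceBeltramiCoord_comp hψ hw htan hv2
    have hmean : ∑ i, ∑ j, (Matrix.of fun i j => ⟪pderivE i (localParam p ι m) y,
        pderivE j (localParam p ι m) y⟫_ℝ)⁻¹ i j • (tangentPlane p ι m)ᗮ.starProjection
          (pderivE i (pderivE j (localParam p ι m)) y) = 0 := hmin m
    rw [hmean, map_zero, add_zero, hψy] at hH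
    rw [laplaceBeltramiCoord_sub _ hcomp hh2, hlap, sub_zero] at hle
    exact absurd hle (not_le.2 ((hpos _ (hιG m)).trans_eq hH.symm))

end MinimalSubmanifold

end

/-! ### The main theorem. -/

theorem theorem5p6 {n p : ℕ} (hp : 1 ≤ p)
    (G : Set (Submodule ℝ (Euc n))) (hG : IsEllipticSet p G)
    (X : TopologicalSpace.Opens (Euc n)) (hX : IsConnected (X : Set (Euc n)))
    (u : Euc n → EReal) (hu : IsUSCPsh (upperCone G) X u) :
    (∀ W : AffineSubspace ℝ (Euc n), W.direction ∈ G →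
      IsConnected ((W : Set (Euc n)) ∩ X) →
        (∀ x ∈ (W : Set (Euc n)) ∩ X, u x = ⊥) ∨
          ∀ a ∈ W, IsSubharmonicOn {y : W.direction | a + (y : Euc n) ∈ X}
            (fun y : W.direction => u (a + (y : Euc n)))) ∧
    (∀ (M : Type*) [TopologicalSpace M] [T2Space M] [ConnectedSpace M]
      [ChartedSpace (Euc p) M] [IsManifold (𝓡 p) ∞ M] (ι : M → Euc n),
      IsImmersedSubmanifold p ι → (∀ m, ι m ∈ X) →
      (∀ m, tangentPlane p ι m ∈ G) → IsMinimalSubmanifold p ι →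
        (∀ m, u (ι m) = ⊥) ∨ IsSubharmonicInduced p ι (fun m => u (ι m))) := by
  refine ⟨fun W hW hWX => ?_, fun M _ _ _ _ _ ι hι hιX hιG hmin => ?_⟩
  · refine or_iff_not_imp_left.2 fun hbot a ha => ?_
    push Not at hbot
    obtain ⟨x, ⟨hxW, hxX⟩, hx⟩ := hbot
    -- Translation by `a` is a topological embedding of the direction space whose image of this set
    -- is `W ∩ X`, so connectedness transfers.
    have hpre : IsPreconnected {y : W.direction | a + (y : Euc n) ∈ X} := by
      have hind : IsInducing fun y : W.direction => a + (y : Euc n) :=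
        (Homeomorph.addLeft a).isInducing.comp IsInducing.subtypeVal
      rw [← hind.isPreconnected_image]
      convert hWX.isPreconnected using 1
      ext z
      constructor
      · rintro ⟨y, hy, rfl⟩
        refine ⟨?_, hy⟩
        simpa [add_comm] using AffineSubspace.vadd_mem_of_mem_direction y.2 ha
      · rintro ⟨hzW, hzX⟩
        exact ⟨⟨z - a, AffineSubspace.vsub_mem_direction hzW ha⟩, by simpa using hzX, by simp⟩
    exact hu.isSubharmonicOn_affine hp hG hW a hpre
      ⟨⟨x - a, AffineSubspace.vsub_mem_direction hxW ha⟩, by simpa using hxX, by simpa using hx⟩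
  · refine or_iff_not_imp_left.2 fun hbot => ?_
    push Not at hbot
    exact hu.isSubharmonicInduced hp hG hι hιX hιG hmin hbot
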